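/- Fix a relational schema (relation names of positive arity whose attributes are typed over two disjoint domains: uninterpreted constants $D$ and the rationals $\mathbb{Q}$) and a set $F$ of denial constraints, i.e. sentences $\forall\bar x.\,\neg[R_1(\bar x_1)\wedge\dots\wedge R_n(\bar x_n)\wedge\varphi(\bar x)]$ with $n>0$, $\bar x=\bar x_1\cup\dots\cup\bar x_n$, and $\varphi$ a well-typed quantifier-free formula over the built-in relations $=,\neq$ (on both domains) and $<,\le,>,\ge$ (on $\mathbb{Q}$). An instance $I$ is a finite set of facts. A set $C\subseteq I$ is a conflict if $C=\{R_1(\rho(\bar x_1)),\dots,R_n(\rho(\bar x_n))\}$ for some constraint in $F$ as above and some substitution $\rho$ of constants for variables making $\varphi$ true; two facts are neighbors if some conflict contains both. A repair of $I$ is a maximal subset of $I$ consistent with $F$. A priority $\succ$ is an acyclic binary relation on $I$ that relates only neighbors; it is total if no other priority extends it. A set $I'\subseteq I$ is globally optimal w.r.t. $\succ$ if there are no nonempty $X\subseteq I'$ and $Y\subseteq I\setminus I'$ such that every $x\in X$ has some $y\in Y$ with $y\succ x$ and $(I'\setminus X)\cup Y$ is consistent with $F$. A common optimal repair of $I$ w.r.t.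 $\succ$ is a repair of $I$ that is globally optimal w.r.t. some total priority extending $\succ$. For $A\subseteq I$ let $\omega_\succ(A)=\{x\in A:\nexists y\in A.\ y\succ x\}$. Consider the following nondeterministic algorithm. Start with $I^o=I$ and $J=\varnothing$. While $\omega_\succ(I^o)\neq\varnothing$: choose any $x\in\omega_\succ(I^o)$, remove $x$ from $I^o$, and, if $J\cup\{x\}$ is consistent with $F$, add $x$ to $J$. Finally return $J$. Theorem. For every instance $I$ and every priority $\succ$ of $I$ w.r.t. $F$: (1) the set of possible outputs of the algorithm on $(I,\succ)$ is exactly the set of common optimal repairs of $I$ w.r.t. $F$ and $\succ$ (soundness and completeness); (2) every run of the algorithm terminates after at most $|I|$ iterations; and, for each fixed finite $F$, the algorithm works in time polynomial in the size of $I$ and $\succ$: there are a nondeterministic program $P$ (a while-program over lists, in which relation names and constants are atomic and the built-in relations are primitive tests) and a polynomial $p$, both depending only on the schema and $F$, such that for every encoding of $(I,\succ)$ of size $N$ as a list of the facts of $I$ and a list of the pairs $x\succ y$, every run of $P$ halts within $p(N)$ elementary steps, and the halting runs of $P$ return exactly the complete executions of the algorithm on $(I,\succ)$, each reported as its sequence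 of choices together with its output $J$. -/

import Mathlib

namespace PrefRepair

universe u v

/-! ### Relational databases and denial constraints -/

/-- The two types of attributes: uninterpreted names and rational numbers. -/
inductive Kind where
  | name
  | num

/-- Constants: the elements of the disjoint domains `D` (uninterpreted) and `ℚ`. -/
inductive Const (D : Type u) where
  | name (d : D)
  | num (q : ℚ)

def Const.kind {D : Type u} : Const D → Kind
  | .name _ => .name
  | .num _ => .num

/-- A schema on a set of relation names: each relation name has a positive arity and a type for
each of its attributes, given by the list `type R`. -/
structure Schema (Rel : Type v) where
  type : Rel → List Kind
  arity_pos : ∀ R, 0 < (type R).length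

/-- A fact `R(t)`, with `t` a tuple of constants of the right types. -/
structure DBFact (D : Type u) {Rel : Type v} (S : Schema Rel) where
  rel : Rel
  args : List (Const D)
  typed : args.map Const.kind = S.type rel

/-- Typed variables. -/
structure Var where
  kind : Kind
  idx : ℕ

/-- A relational atom `R(x̄)`, with `x̄` a tuple of variables of the right types. -/
structure RelAtom {Rel : Type v} (S : Schema Rel) where
  rel : Rel
  vars : List Var
  typed : vars.map Var.kind = S.type rel

inductive Term (D : Type u) where
  | var (x : Var)
  | const (c : Const D)

/-- The built-in relation symbols `=, ≠, <, ≤, >, ≥`. -/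
inductive Cmp where
  | eq
  | ne
  | lt
  | le
  | gt
  | ge

def Cmp.IsOrder : Cmp → Prop
  | .eq => False
  | .ne => False
  | .lt => True
  | .le => True
  | .gt => True
  | .ge => True

/-- Interpretation of the built-in relations. The order symbols are interpreted over `ℚ` only. -/
def Cmp.Holds {D : Type u} : Cmp → Const D → Const D → Prop
  | .eq, a, b => a = b
  | .ne, a, b => a ≠ b
  | .lt, .num p, .num q => p < q
  | .le, .num p, .num q => p ≤ q
  | .gt, .num p, .num q => p > q
  | .ge, .num p, .num q => p ≥ q
  | _, _, _ => False

/-- Quantifier-free formulas over the built-in relations. -/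
inductive Formula (D : Type u) where
  | tru
  | cmp (op : Cmp) (s t : Term D)
  | not (φ : Formula D)
  | and (φ ψ : Formula D)
  | or (φ ψ : Formula D)

def Term.kind {D : Type u} : Term D → Kind
  | .var x => x.kind
  | .const c => c.kind

def Term.HasVar {D : Type u} (x : Var) : Term D → Prop
  | .var y => x = y
  | .const _ => False

def Term.eval {D : Type u} (ρ : Var → Const D) : Term D → Const D
  | .var x => ρ x
  | .const c => c

/-- The variable `x` occurs in the formula. -/
def Formula.HasVar {D : Type u} (x : Var) : Formula D → Prop
  | .tru => False
  | .cmp _ s t => s.HasVar x ∨ t.HasVar x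
  | .not φ => φ.HasVar x
  | .and φ ψ => φ.HasVar x ∨ ψ.HasVar x
  | .or φ ψ => φ.HasVar x ∨ ψ.HasVar x

/-- Only terms of the same type are compared, and the order symbols are used on `ℚ` only. -/
def Formula.WellTyped {D : Type u} : Formula D → Prop
  | .tru => True
  | .cmp op s t => s.kind = t.kind ∧ (op.IsOrder → s.kind = .num)
  | .not φ => φ.WellTyped
  | .and φ ψ => φ.WellTyped ∧ ψ.WellTyped
  | .or φ ψ => φ.WellTyped ∧ ψ.WellTyped

def Formula.Holds {D : Type u} (ρ : Var → Const D) : Formula D → Prop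
  | .tru => True
  | .cmp op s t => op.Holds (s.eval ρ) (t.eval ρ)
  | .not φ => ¬ φ.Holds ρ
  | .and φ ψ => φ.Holds ρ ∧ ψ.Holds ρ
  | .or φ ψ => φ.Holds ρ ∨ ψ.Holds ρ

/-- The denial constraint `∀ x̄. ¬ [R₁(x̄₁) ∧ … ∧ Rₙ(x̄ₙ) ∧ φ(x̄)]` with `n > 0`, where each variable
of `φ` occurs in some `x̄ᵢ`. -/
structure DenialConstraint (D : Type u) {Rel : Type v} (S : Schema Rel) where
  atoms : List (RelAtom S)
  atoms_ne : atoms ≠ []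
  cond : Formula D
  typed : cond.WellTyped
  safe : ∀ x, cond.HasVar x → ∃ a ∈ atoms, x ∈ a.vars

section Repairs

variable {D : Type u} {Rel : Type v} {S : Schema Rel}

/-- `f` is the ground instance of the atom `a` under the substitution `ρ`. As atoms and facts are
typed, `ρ` then respects the types of the variables of `a`. -/
def RelAtom.Matches (ρ : Var → Const D) (a : RelAtom S) (f : DBFact D S) : Prop :=
  f.rel = a.rel ∧ f.args = a.vars.map ρ

/-- `J ⊨ c`. -/
def DenialConstraint.Sat (c : DenialConstraint D S) (J : Set (DBFact D S)) : Prop :=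
  ∀ ρ : Var → Const D, ¬ ((∀ a ∈ c.atoms, ∃ f ∈ J, a.Matches ρ f) ∧ c.cond.Holds ρ)

/-- `J ⊨ F`. -/
def Consistent (F : Set (DenialConstraint D S)) (J : Set (DBFact D S)) : Prop :=
  ∀ c ∈ F, c.Sat J

/-- `I'` is a repair of `I`: a maximal consistent subset. -/
def IsRepair (I : Set (DBFact D S)) (F : Set (DenialConstraint D S)) (I' : Set (DBFact D S)) : Prop :=
  Maximal (fun J => J ⊆ I ∧ Consistent F J) I'

/-- `C` is a conflict in `I`: the set of ground instances, all of them in `I`, of the atoms of some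
constraint under a substitution that makes its condition true. -/
def IsConflict (I : Set (DBFact D S)) (F : Set (DenialConstraint D S)) (C : Set (DBFact D S)) : Prop :=
  C ⊆ I ∧ ∃ c ∈ F, ∃ ρ : Var → Const D, c.cond.Holds ρ ∧
    (∀ a ∈ c.atoms, ∃ f ∈ C, a.Matches ρ f) ∧ (∀ f ∈ C, ∃ a ∈ c.atoms, a.Matches ρ f)

def Neighbors (I : Set (DBFact D S)) (F : Set (DenialConstraint D S)) (x y : DBFact D S) : Prop :=
  ∃ C, IsConflict I F C ∧ x ∈ C ∧ y ∈ C

/-- A priority: an acyclic relation (`r x y` reads `x ≻ y`) between neighboring facts of `I`. -/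
structure IsPriority (I : Set (DBFact D S)) (F : Set (DenialConstraint D S))
    (r : DBFact D S → DBFact D S → Prop) : Prop where
  acyclic : ∀ x, ¬ Relation.TransGen r x x
  neighbors : ∀ x y, r x y → Neighbors I F x y

/-- `r'` is an extension of `r`. -/
def Extends (r' r : DBFact D S → DBFact D S → Prop) : Prop :=
  ∀ x y, r x y → r' x y

/-- A total priority: one with no extension other than itself. -/
def IsTotalPriority (I : Set (DBFact D S)) (F : Set (DenialConstraint D S))
    (r : DBFact D S → DBFact D S → Prop) : Prop :=
  IsPriority I F r ∧ ∀ r', IsPriority I F r' → Extends r' r → r' = r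

def GloballyOptimal (I : Set (DBFact D S)) (F : Set (DenialConstraint D S))
    (r : DBFact D S → DBFact D S → Prop) (I' : Set (DBFact D S)) : Prop :=
  I' ⊆ I ∧ ∀ X Y : Set (DBFact D S), X ⊆ I' → X.Nonempty → Y ⊆ I \ I' →
    (∀ x ∈ X, ∃ y ∈ Y, r y x) → ¬ Consistent F ((I' \ X) ∪ Y)

def CommonOptimal (I : Set (DBFact D S)) (F : Set (DenialConstraint D S))
    (r : DBFact D S → DBFact D S → Prop) (I' : Set (DBFact D S)) : Prop :=
  ∃ r', IsTotalPriority I F r' ∧ Extends r' r ∧ GloballyOptimal I F r' I'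

/-- The set of common optimal repairs of `I`. -/
def CRep (I : Set (DBFact D S)) (F : Set (DenialConstraint D S))
    (r : DBFact D S → DBFact D S → Prop) : Set (Set (DBFact D S)) :=
  {I' | IsRepair I F I' ∧ CommonOptimal I F r I'}

/-! ### The greedy algorithm -/

/-- The winnow operator: the undominated elements of `A`. -/
def winnow (r : DBFact D S → DBFact D S → Prop) (A : Set (DBFact D S)) : Set (DBFact D S) :=
  {x ∈ A | ¬ ∃ y ∈ A, r y x}

/-- `Run F r A J xs A' J'`: from the state with remaining facts `A` and current instance `J`, the
main loop reaches the state `(A', J')` by making the sequence of choices `xs`, one per iteration. -/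
inductive Run (F : Set (DenialConstraint D S)) (r : DBFact D S → DBFact D S → Prop) :
    Set (DBFact D S) → Set (DBFact D S) → List (DBFact D S) → Set (DBFact D S) → Set (DBFact D S) → Prop
  | refl (A J) : Run F r A J [] A J
  | add {A J xs A' J'} (x : DBFact D S) (hx : x ∈ winnow r A) (hc : Consistent F (insert x J))
      (h : Run F r (A \ {x}) (insert x J) xs A' J') : Run F r A J (x :: xs) A' J'
  | discard {A J xs A' J'} (x : DBFact D S) (hx : x ∈ winnow r A)
      (hc : ¬ Consistent F (insert x J))
      (h : Run F r (A \ {x}) J xs A' J') : Run F r A J (x :: xs) A' J'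

/-- A complete execution on `I` with the sequence of choices `xs`, returning `J`: the loop is left
when the winnow of the remaining facts is empty. -/
def Execution (I : Set (DBFact D S)) (F : Set (DenialConstraint D S))
    (r : DBFact D S → DBFact D S → Prop) (xs : List (DBFact D S)) (J : Set (DBFact D S)) : Prop :=
  ∃ A, Run F r I ∅ xs A J ∧ winnow r A = ∅

end Repairs

/-! ### A machine model with a step count

Nondeterministic while-programs over S-expressions. The atoms are relation names and constants;
the built-in relations on constants are primitive tests. -/

inductive Val (D : Type u) (Rel : Type v) where
  | nil
  | rel (R : Rel)
  | const (c : Const D)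
  | cons (a b : Val D Rel)

/-- Expressions; registers are numbered. -/
inductive Expr (D : Type u) (Rel : Type v) where
  | reg (n : ℕ)
  | nil
  | rel (R : Rel)
  | const (c : Const D)
  | cons (e₁ e₂ : Expr D Rel)
  | hd (e : Expr D Rel)
  | tl (e : Expr D Rel)

inductive Test (D : Type u) (Rel : Type v) where
  | isNil (e : Expr D Rel)
  | same (e₁ e₂ : Expr D Rel)
  | cmp (op : Cmp) (e₁ e₂ : Expr D Rel)
  | not (b : Test D Rel)
  | and (b₁ b₂ : Test D Rel)
  | or (b₁ b₂ : Test D Rel)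

inductive Cmd (D : Type u) (Rel : Type v) where
  | skip
  | assign (n : ℕ) (e : Expr D Rel)
  | seq (c₁ c₂ : Cmd D Rel)
  | ite (b : Test D Rel) (c₁ c₂ : Cmd D Rel)
  | loop (b : Test D Rel) (c : Cmd D Rel)
  | choose (c₁ c₂ : Cmd D Rel)

section Machine

variable {D : Type u} {Rel : Type v}

/-- The number of cells of an S-expression. -/
def Val.size : Val D Rel → ℕ
  | .nil => 1
  | .rel _ => 1
  | .const _ => 1
  | .cons a b => a.size + b.size + 1

def Val.hd : Val D Rel → Val D Rel
  | .cons a _ => a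
  | _ => .nil

def Val.tl : Val D Rel → Val D Rel
  | .cons _ b => b
  | _ => .nil

def Val.ofList : List (Val D Rel) → Val D Rel
  | [] => .nil
  | a :: l => .cons a (Val.ofList l)

def Expr.eval (σ : ℕ → Val D Rel) : Expr D Rel → Val D Rel
  | .reg n => σ n
  | .nil => .nil
  | .rel R => .rel R
  | .const c => .const c
  | .cons e₁ e₂ => .cons (e₁.eval σ) (e₂.eval σ)
  | .hd e => (e.eval σ).hd
  | .tl e => (e.eval σ).tl

/-- Each operation of an expression takes one unit of time. -/
def Expr.cost : Expr D Rel → ℕ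
  | .reg _ => 1
  | .nil => 1
  | .rel _ => 1
  | .const _ => 1
  | .cons e₁ e₂ => e₁.cost + e₂.cost + 1
  | .hd e => e.cost + 1
  | .tl e => e.cost + 1

def Test.Holds (σ : ℕ → Val D Rel) : Test D Rel → Prop
  | .isNil e => e.eval σ = .nil
  | .same e₁ e₂ => e₁.eval σ = e₂.eval σ
  | .cmp op e₁ e₂ => ∃ a b, e₁.eval σ = .const a ∧ e₂.eval σ = .const b ∧ op.Holds a b
  | .not b => ¬ b.Holds σ
  | .and b₁ b₂ => b₁.Holds σ ∧ b₂.Holds σ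
  | .or b₁ b₂ => b₁.Holds σ ∨ b₂.Holds σ

/-- Each operation of a test takes one unit of time, except that comparing two S-expressions
takes time proportional to their sizes. -/
def Test.cost (σ : ℕ → Val D Rel) : Test D Rel → ℕ
  | .isNil e => e.cost + 1
  | .same e₁ e₂ => e₁.cost + e₂.cost + (e₁.eval σ).size + (e₂.eval σ).size + 1
  | .cmp _ e₁ e₂ => e₁.cost + e₂.cost + 1
  | .not b => b.cost σ + 1
  | .and b₁ b₂ => b₁.cost σ + b₂.cost σ + 1
  | .or b₁ b₂ => b₁.cost σ + b₂.cost σ + 1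

/-- A configuration: the stack of commands still to be executed, and the registers. The machine
halts when the stack is empty. -/
abbrev Config (D : Type u) (Rel : Type v) := List (Cmd D Rel) × (ℕ → Val D Rel)

/-- `Step c t c'`: the machine can pass from `c` to `c'` in one transition, which takes time `t`. -/
inductive Step : Config D Rel → ℕ → Config D Rel → Prop
  | skip (K σ) : Step (.skip :: K, σ) 1 (K, σ)
  | assign (n e K σ) :
      Step (.assign n e :: K, σ) (e.cost + 1) (K, Function.update σ n (e.eval σ))
  | seq (c₁ c₂ K σ) : Step (.seq c₁ c₂ :: K, σ) 1 (c₁ :: c₂ :: K, σ)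
  | ite_true (b c₁ c₂ K σ) (h : b.Holds σ) :
      Step (.ite b c₁ c₂ :: K, σ) (b.cost σ + 1) (c₁ :: K, σ)
  | ite_false (b c₁ c₂ K σ) (h : ¬ b.Holds σ) :
      Step (.ite b c₁ c₂ :: K, σ) (b.cost σ + 1) (c₂ :: K, σ)
  | loop_true (b c K σ) (h : b.Holds σ) :
      Step (.loop b c :: K, σ) (b.cost σ + 1) (c :: .loop b c :: K, σ)
  | loop_false (b c K σ) (h : ¬ b.Holds σ) :
      Step (.loop b c :: K, σ) (b.cost σ + 1) (K, σ)
  | choose_left (c₁ c₂ K σ) : Step (.choose c₁ c₂ :: K, σ) 1 (c₁ :: K, σ)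
  | choose_right (c₁ c₂ K σ) : Step (.choose c₁ c₂ :: K, σ) 1 (c₂ :: K, σ)

/-- `Reaches c t c'`: the machine can pass from `c` to `c'` in total time `t`. -/
inductive Reaches : Config D Rel → ℕ → Config D Rel → Prop
  | refl (c) : Reaches c 0 c
  | step {c t c' t' c''} (h : Step c t c') (h' : Reaches c' t' c'') : Reaches c (t + t') c''

/-- The program `P` started with `input` in register `0` and all the other registers empty. -/
def initial (P : Cmd D Rel) (input : Val D Rel) : Config D Rel :=
  ([P], Function.update (fun _ => .nil) 0 input)

/-- Some run of `P` on `input` halts with `output` in register `0`. -/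
def Returns (P : Cmd D Rel) (input output : Val D Rel) : Prop :=
  ∃ t σ, Reaches (initial P input) t ([], σ) ∧ σ 0 = output

/-- Every run of `P` on `input`, whatever choices it makes, halts within time `T` (each transition
takes positive time, and only configurations with an empty stack have no transition). -/
def HaltsWithin (P : Cmd D Rel) (input : Val D Rel) (T : ℕ) : Prop :=
  ∀ t c, Reaches (initial P input) t c → t ≤ T

variable {S : Schema Rel}

/-- The S-expression `(R t₁ … tₖ)`. -/
def DBFact.encode (f : DBFact D S) : Val D Rel :=
  .cons (.rel f.rel) (.ofList (f.args.map .const))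

def encodeFacts (l : List (DBFact D S)) : Val D Rel :=
  .ofList (l.map DBFact.encode)

def encodePairs (l : List (DBFact D S × DBFact D S)) : Val D Rel :=
  .ofList (l.map fun p => .cons p.1.encode p.2.encode)

/-- The list `l` enumerates the set `A` without repetition. -/
def Lists {α : Type*} (l : List α) (A : Set α) : Prop :=
  l.Nodup ∧ ∀ x, x ∈ l ↔ x ∈ A

/-- `v` is an encoding of the instance `I` together with the priority `r`: a list of the facts of
`I` and a list of the pairs `(x, y)` with `x ≻ y`. -/
def EncodesInput (v : Val D Rel) (I : Set (DBFact D S)) (r : DBFact D S → DBFact D S → Prop) : Prop :=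
  ∃ lI lr, Lists lI I ∧ Lists lr {p : DBFact D S × DBFact D S | r p.1 p.2} ∧
    v = .cons (encodeFacts lI) (encodePairs lr)

/-- `v` is an encoding of the sequence of choices `xs` together with the instance `J`. -/
def EncodesOutput (v : Val D Rel) (xs : List (DBFact D S)) (J : Set (DBFact D S)) : Prop :=
  ∃ lJ, Lists lJ J ∧ v = .cons (encodeFacts xs) (encodeFacts lJ)

/-- `P` implements the greedy algorithm for the constraints `F`: on each input its halting runs
return exactly the complete executions of the algorithm, each being reported as its sequence of
choices and its result. -/
def Implements (P : Cmd D Rel) (F : Set (DenialConstraint D S)) : Prop :=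
  ∀ (I : Set (DBFact D S)) (r : DBFact D S → DBFact D S → Prop) (input : Val D Rel),
    I.Finite → IsPriority I F r → EncodesInput input I r →
      (∀ out, Returns P input out → ∃ xs J, Execution I F r xs J ∧ EncodesOutput out xs J) ∧
      (∀ xs J, Execution I F r xs J → ∃ out, Returns P input out ∧ EncodesOutput out xs J)

/-- On each input of size `n`, every run of `P` halts within time `p(n)`, for a polynomial `p`. -/
def PolyTime (P : Cmd D Rel) (F : Set (DenialConstraint D S)) : Prop :=
  ∃ p : Polynomial ℕ, ∀ (I : Set (DBFact D S)) (r : DBFact D S → DBFact D S → Prop) (input : Val D Rel),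
    I.Finite → IsPriority I F r → EncodesInput input I r →
      HaltsWithin P input (p.eval input.size)

end Machine

end PrefRepair

open PrefRepair

/-!
Soundness. A run chooses each fact before every fact it dominates, so ordering conflicting
neighbors by the time at which they are chosen gives a total priority extending the given one.
Whenever a fact is rejected, it forms a conflict with facts kept earlier; hence an improvement
`(J \ X) ∪ Y` would have to displace, for the earliest chosen `y ∈ Y`, a kept fact chosen before
`y`, and this fact in turn would be dominated by a still earlier element of `Y`.

Completeness. Given a total priority for which `J` is globally optimal, repeatedly choose a
winner of the *total* priority, which is also a winner of the given one. Global optimality forces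
the kept facts to be exactly the elements of `J` met so far.

Running time. Nondeterministic programs are analysed by a Hoare logic with time bounds in which the
choices are made either by an adversary or by an ally. One correctness proof, parametric in who
chooses, then bounds all runs and at the same time produces the run for each given execution.
Consistency is tested by trying all tuples of facts of the length of each constraint, which is
polynomial because the constraints are fixed.
-/

namespace PrefRepair

universe u v

section Acyclic

variable {α : Type*} {r : α → α → Prop} {a b x y : α}

theorem transGen_or_pair
    (h : Relation.TransGen (fun u v => r u v ∨ (u = a ∧ v = b)) x y) :
    Relation.TransGen r x y ∨ (Relation.ReflTransGen r x a ∧ Relation.ReflTransGen r b y) := by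
  induction h with
  | single h =>
    rcases h with h | ⟨rfl, rfl⟩
    · exact .inl (.single h)
    · exact .inr ⟨.refl, .refl⟩
  | tail _ h ih =>
    rcases h with h | ⟨rfl, rfl⟩
    · exact ih.imp (·.tail h) fun ⟨hxa, hby⟩ => ⟨hxa, hby.tail h⟩
    · exact .inr ⟨ih.elim (·.to_reflTransGen) (·.1), .refl⟩

theorem acyclic_or_pair (hr : ∀ x, ¬ Relation.TransGen r x x)
    (hba : ¬ Relation.ReflTransGen r b a) :
    ∀ x, ¬ Relation.TransGen (fun u v => r u v ∨ (u = a ∧ v = b)) x x := by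
  intro x hx
  rcases transGen_or_pair hx with h | ⟨hxa, hbx⟩
  · exact hr x h
  · exact hba (hbx.trans hxa)

end Acyclic

section Greedy

variable {D : Type u} {Rel : Type v} {S : Schema Rel} {F : Set (DenialConstraint D S)}
  {r r' : DBFact D S → DBFact D S → Prop} {I A A' J J' C : Set (DBFact D S)}
  {x y : DBFact D S} {xs ys : List (DBFact D S)}

/-! ### Conflicts -/

theorem DBFact.eq_of_rel_args {f g : DBFact D S} (hrel : f.rel = g.rel) (hargs : f.args = g.args) :
    f = g := by
  cases f
  cases g
  simp_all only

theorem RelAtom.Matches.unique {ρ : Var → Const D} {a : RelAtom S} {f g : DBFact D S}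
    (hf : a.Matches ρ f) (hg : a.Matches ρ g) : f = g :=
  DBFact.eq_of_rel_args (hf.1.trans hg.1.symm) (hf.2.trans hg.2.symm)

theorem Consistent.mono (h : Consistent F J) (hJ : J' ⊆ J) : Consistent F J' :=
  fun c hc ρ ⟨hatoms, hcond⟩ =>
    h c hc ρ ⟨fun a ha => (hatoms a ha).imp fun _ hf => ⟨hJ hf.1, hf.2⟩, hcond⟩

theorem consistent_empty : Consistent F (∅ : Set (DBFact D S)) := by
  rintro c - ρ ⟨hatoms, -⟩
  obtain ⟨a, ha⟩ := List.exists_mem_of_ne_nil _ c.atoms_ne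
  obtain ⟨f, hf, -⟩ := hatoms a ha
  exact hf

theorem exists_isConflict (h : ¬ Consistent F J) : ∃ C, IsConflict J F C := by
  simp only [Consistent, DenialConstraint.Sat, not_forall, not_not] at h
  obtain ⟨c, hc, ρ, hatoms, hcond⟩ := h
  refine ⟨{f | ∃ a ∈ c.atoms, a.Matches ρ f}, ?_, c, hc, ρ, hcond, ?_, fun f hf => hf⟩
  · rintro f ⟨a, ha, hf⟩
    obtain ⟨g, hg, hg'⟩ := hatoms a ha
    rwa [hf.unique hg']
  · intro a ha
    obtain ⟨g, -, hg⟩ := hatoms a ha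
    exact ⟨g, ⟨a, ha, hg⟩, hg⟩

theorem IsConflict.not_consistent (h : IsConflict I F C) (hC : C ⊆ J) : ¬ Consistent F J := by
  obtain ⟨-, c, hc, ρ, hcond, hatoms, -⟩ := h
  exact fun hJ => hJ.mono hC c hc ρ ⟨hatoms, hcond⟩

theorem IsConflict.mono (h : IsConflict I F C) (hI : I ⊆ J) : IsConflict J F C :=
  ⟨h.1.trans hI, h.2⟩

theorem Neighbors.symm (h : Neighbors I F x y) : Neighbors I F y x :=
  h.imp fun _ ⟨hC, hx, hy⟩ => ⟨hC, hy, hx⟩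

theorem Neighbors.left_mem (h : Neighbors I F x y) : x ∈ I :=
  let ⟨_, hC, hx, _⟩ := h
  hC.1 hx

theorem Neighbors.right_mem (h : Neighbors I F x y) : y ∈ I :=
  h.symm.left_mem

/-! ### Total priorities -/

theorem IsTotalPriority.rel_or_reflTransGen (h : IsTotalPriority I F r) (hxy : Neighbors I F x y) :
    r x y ∨ Relation.ReflTransGen r y x := by
  by_contra! hcon
  have hext : IsPriority I F fun u v => r u v ∨ (u = x ∧ v = y) := by
    refine ⟨acyclic_or_pair h.1.acyclic hcon.2, ?_⟩
    rintro u v (huv | ⟨rfl, rfl⟩)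
    · exact h.1.neighbors u v huv
    · exact hxy
  have heq := h.2 _ hext fun _ _ => .inl
  exact hcon.1 (heq ▸ .inr ⟨rfl, rfl⟩)

theorem IsTotalPriority.comparable (h : IsTotalPriority I F r) (hxy : Neighbors I F x y)
    (hne : x ≠ y) : r x y ∨ r y x := by
  by_contra! hcon
  have hyx := (h.rel_or_reflTransGen hxy).resolve_left hcon.1
  have hxy := (h.rel_or_reflTransGen hxy.symm).resolve_left hcon.2
  rcases Relation.reflTransGen_iff_eq_or_transGen.1 hyx with rfl | hyx
  · exact hne rfl
  · exact h.1.acyclic y (hyx.trans_left hxy)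

theorem isTotalPriority_of_injOn {α : Type*} [LinearOrder α] {k : DBFact D S → α}
    (hk : Set.InjOn k I) : IsTotalPriority I F fun x y => Neighbors I F x y ∧ k x < k y := by
  have hlt : ∀ x y, Relation.TransGen (fun x y => Neighbors I F x y ∧ k x < k y) x y →
      k x < k y := fun x y h => by
    simpa only [Relation.transGen_eq_self] using
      h.lift (p := (· < ·)) k fun (_ _ : DBFact D S) h => h.2
  refine ⟨⟨fun x hx => lt_irrefl _ (hlt x x hx), fun x y h => h.1⟩, fun r' hr' hext => ?_⟩
  funext x y
  refine propext ⟨fun hxy => ?_, hext x y⟩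
  have hn := hr'.neighbors x y hxy
  refine ⟨hn, lt_of_not_ge fun hle => ?_⟩
  rcases hle.eq_or_lt with heq | hlt
  · exact hr'.acyclic x (.single (hk hn.right_mem hn.left_mem heq ▸ hxy))
  · exact hr'.acyclic x (.tail (.single hxy) (hext y x ⟨hn.symm, hlt⟩))

/-! ### Runs of the main loop -/

theorem winnow_nonempty (hr : ∀ x, ¬ Relation.TransGen r x x) (hA : A.Finite)
    (hne : A.Nonempty) : (winnow r A).Nonempty := by
  have : IsStrictOrder (DBFact D S) (Relation.TransGen r) :=
    { irrefl := hr, trans := fun _ _ _ => .trans }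
  obtain ⟨⟨x, hx⟩, -, hmin⟩ :=
    hA.wellFoundedOn (r := Relation.TransGen r).has_min Set.univ ⟨⟨_, hne.some_mem⟩, trivial⟩
  exact ⟨x, hx, fun ⟨y, hy, hyx⟩ => hmin ⟨y, hy⟩ trivial (.single hyx)⟩

open Classical in
/-- The effect on `J` of choosing `x` in an iteration of the greedy algorithm. -/
noncomputable def tryInsert (F : Set (DenialConstraint D S)) (J : Set (DBFact D S))
    (x : DBFact D S) : Set (DBFact D S) :=
  if Consistent F (insert x J) then insert x J else J

theorem tryInsert_of_consistent (h : Consistent F (insert x J)) : tryInsert F J x = insert x J :=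
  if_pos h

theorem tryInsert_of_not_consistent (h : ¬ Consistent F (insert x J)) : tryInsert F J x = J :=
  if_neg h

theorem subset_tryInsert : J ⊆ tryInsert F J x := by
  rw [tryInsert]
  split_ifs
  exacts [Set.subset_insert x J, subset_rfl]

theorem tryInsert_subset : tryInsert F J x ⊆ insert x J := by
  rw [tryInsert]
  split_ifs
  exacts [subset_rfl, Set.subset_insert x J]

theorem Consistent.tryInsert (h : Consistent F J) : Consistent F (tryInsert F J x) := by
  rw [PrefRepair.tryInsert]
  split_ifs with hx
  exacts [hx, h]

theorem run_nil_iff : Run F r A J [] A' J' ↔ A = A' ∧ J = J' := by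
  constructor
  · rintro ⟨⟩
    exact ⟨rfl, rfl⟩
  · rintro ⟨rfl, rfl⟩
    exact .refl A J

theorem run_cons_iff : Run F r A J (x :: xs) A' J' ↔
    x ∈ winnow r A ∧ Run F r (A \ {x}) (tryInsert F J x) xs A' J' := by
  constructor
  · rintro (_ | ⟨_, hx, hc, h⟩ | ⟨_, hx, hc, h⟩)
    · exact ⟨hx, by rwa [tryInsert_of_consistent hc]⟩
    · exact ⟨hx, by rwa [tryInsert_of_not_consistent hc]⟩
  · rintro ⟨hx, h⟩
    by_cases hc : Consistent F (insert x J)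
    · exact .add x hx hc (by rwa [tryInsert_of_consistent hc] at h)
    · exact .discard x hx hc (by rwa [tryInsert_of_not_consistent hc] at h)

theorem run_append_iff : Run F r A J (xs ++ ys) A' J' ↔
    ∃ A₁ J₁, Run F r A J xs A₁ J₁ ∧ Run F r A₁ J₁ ys A' J' := by
  induction xs generalizing A J with
  | nil => simp only [List.nil_append, run_nil_iff, and_assoc, exists_and_left, exists_eq_left']
  | cons x xs ih => simp only [List.cons_append, run_cons_iff, ih, and_assoc, exists_and_left]

theorem Run.length_le (h : Run F r A J xs A' J') (hA : A.Finite) : xs.length ≤ A.ncard := by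
  induction xs generalizing A J with
  | nil => exact Nat.zero_le _
  | cons x xs ih =>
    obtain ⟨hx, h⟩ := run_cons_iff.1 h
    rw [List.length_cons, ← Set.ncard_sdiff_singleton_add_one hx.1 hA]
    exact Nat.succ_le_succ (ih h hA.sdiff)

theorem Run.remaining_eq (h : Run F r A J xs A' J') : A' = A \ {x | x ∈ xs} := by
  induction xs generalizing A J with
  | nil => simpa [eq_comm] using (run_nil_iff.1 h).1
  | cons x xs ih =>
    rw [ih (run_cons_iff.1 h).2, Set.sdiff_sdiff]
    congr 1
    ext y
    simp only [Set.mem_union, Set.mem_singleton_iff, Set.mem_ofPred_eq, List.mem_cons]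

theorem Run.mem_of_mem (h : Run F r A J xs A' J') (hx : x ∈ xs) : x ∈ A := by
  induction xs generalizing A J with
  | nil => cases hx
  | cons y ys ih =>
    obtain ⟨hy, h⟩ := run_cons_iff.1 h
    rcases List.mem_cons.1 hx with rfl | hx
    exacts [hy.1, (ih h hx).1]

theorem Run.subset_kept (h : Run F r A J xs A' J') : J ⊆ J' := by
  induction xs generalizing A J with
  | nil => exact (run_nil_iff.1 h).2.subset
  | cons x xs ih => exact subset_tryInsert.trans (ih (run_cons_iff.1 h).2)

theorem Run.kept_subset (h : Run F r A J xs A' J') : J' ⊆ J ∪ {x | x ∈ xs} := by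
  induction xs generalizing A J with
  | nil => exact (run_nil_iff.1 h).2.superset.trans Set.subset_union_left
  | cons x xs ih =>
    refine (ih (run_cons_iff.1 h).2).trans (Set.union_subset ?_ fun y hy => .inr (.tail x hy))
    exact tryInsert_subset.trans (Set.insert_subset (.inr (.head xs)) Set.subset_union_left)

theorem Run.consistent (h : Run F r A J xs A' J') (hJ : Consistent F J) : Consistent F J' := by
  induction xs generalizing A J with
  | nil => exact (run_nil_iff.1 h).2 ▸ hJ
  | cons x xs ih => exact ih (run_cons_iff.1 h).2 hJ.tryInsert

theorem Run.of_extends (h : Run F r' A J xs A' J') (hext : Extends r' r) :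
    Run F r A J xs A' J' := by
  induction xs generalizing A J with
  | nil => exact run_nil_iff.2 (run_nil_iff.1 h)
  | cons x xs ih =>
    obtain ⟨hx, h⟩ := run_cons_iff.1 h
    exact run_cons_iff.2 ⟨⟨hx.1, fun ⟨y, hy, hyx⟩ => hx.2 ⟨y, hy, hext y x hyx⟩⟩, ih h⟩

theorem exists_run (hr : ∀ x, ¬ Relation.TransGen r x x) (hA : A.Finite) :
    ∃ xs J', Run F r A J xs ∅ J' := by
  induction hn : A.ncard generalizing A J with
  | zero =>
    obtain rfl := (Set.ncard_eq_zero hA).1 hn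
    exact ⟨[], J, .refl _ _⟩
  | succ n ih =>
    obtain ⟨x, hx⟩ := winnow_nonempty hr hA (Set.nonempty_of_ncard_ne_zero (by omega))
    have hcard := Set.ncard_sdiff_singleton_add_one hx.1 hA
    obtain ⟨xs, J', h⟩ := ih (J := tryInsert F J x) (hA.sdiff (t := {x})) (by omega)
    exact ⟨x :: xs, J', run_cons_iff.2 ⟨hx, h⟩⟩

theorem winnow_empty : winnow r (∅ : Set (DBFact D S)) = ∅ :=
  Set.eq_empty_of_forall_notMem fun _ hx => hx.1

theorem execution_iff_run (hI : I.Finite) (hr : ∀ x, ¬ Relation.TransGen r x x) :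
    Execution I F r xs J ↔ Run F r I ∅ xs ∅ J := by
  refine ⟨fun ⟨A, hrun, hA⟩ => ?_, fun h => ⟨∅, h, winnow_empty⟩⟩
  rcases A.eq_empty_or_nonempty with rfl | hne
  · exact hrun
  · have hfin : A.Finite := hI.subset (hrun.remaining_eq ▸ Set.sdiff_subset)
    exact absurd hA (winnow_nonempty hr hfin hne).ne_empty

/-! ### Soundness -/

theorem Run.exists_split (h : Run F r I ∅ xs ∅ J) (hy : y ∈ I) :
    ∃ pre post J₁, xs = pre ++ y :: post ∧ y ∉ pre ∧ (∀ x ∈ I, r x y → x ∈ pre) ∧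
      J₁ ⊆ J ∧ J₁ ⊆ {z | z ∈ pre} ∧ (y ∉ J → ¬ Consistent F (insert y J₁)) := by
  have hmem : y ∈ xs := by
    by_contra hy'
    have : y ∈ I \ {x | x ∈ xs} := ⟨hy, hy'⟩
    rwa [← h.remaining_eq] at this
  obtain ⟨pre, post, rfl, hpre⟩ := List.eq_append_cons_of_mem hmem
  obtain ⟨A₁, J₁, hbefore, hafter⟩ := run_append_iff.1 h
  obtain ⟨hyw, hafter⟩ := run_cons_iff.1 hafter
  refine ⟨pre, post, J₁, rfl, hpre, fun x hx hxy => ?_, subset_tryInsert.trans hafter.subset_kept,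
    by simpa using hbefore.kept_subset, fun hyJ hc => hyJ ?_⟩
  · by_contra hx'
    exact hyw.2 ⟨x, hbefore.remaining_eq ▸ ⟨hx, hx'⟩, hxy⟩
  · exact hafter.subset_kept (tryInsert_of_consistent hc ▸ Set.mem_insert y J₁)

theorem Run.kept_subset_init (h : Run F r I ∅ xs A J) : J ⊆ I := fun _ hx =>
  h.mem_of_mem ((h.kept_subset hx).resolve_left (Set.notMem_empty _))

theorem idxOf_lt_idxOf_append_cons {α : Type*} [DecidableEq α] {a b : α} {pre post : List α}
    (ha : a ∈ pre) (hb : b ∉ pre) :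
    (pre ++ b :: post).idxOf a < (pre ++ b :: post).idxOf b := by
  rw [List.idxOf_append_of_mem ha, List.idxOf_append_of_notMem hb]
  exact (List.idxOf_lt_length_of_mem ha).trans_le (Nat.le_add_right _ _)

section Order

variable [DecidableEq (DBFact D S)]

theorem Run.idxOf_lt_idxOf (h : Run F r I ∅ xs ∅ J) (hx : x ∈ I) (hy : y ∈ I) (hxy : r x y) :
    xs.idxOf x < xs.idxOf y := by
  obtain ⟨pre, post, -, rfl, hpre, hbefore, -⟩ := h.exists_split hy
  exact idxOf_lt_idxOf_append_cons (hbefore x hx hxy) hpre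

theorem Run.injOn_idxOf (h : Run F r I ∅ xs ∅ J) : Set.InjOn (xs.idxOf ·) I := by
  intro x hx y _ hxy
  obtain ⟨pre, post, -, rfl, -⟩ := h.exists_split hx
  exact (List.idxOf_inj (by simp)).1 hxy

theorem Run.not_consistent_insert_earlier (h : Run F r I ∅ xs ∅ J) (hy : y ∈ I) (hyJ : y ∉ J) :
    ¬ Consistent F (insert y {z ∈ J | xs.idxOf z < xs.idxOf y}) := by
  obtain ⟨pre, post, J₁, rfl, hpre, -, hJ₁, hJ₁pre, hc⟩ := h.exists_split hy
  refine fun hcon => hc hyJ (hcon.mono (Set.insert_subset_insert fun z hz => ⟨hJ₁ hz, ?_⟩))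
  exact idxOf_lt_idxOf_append_cons (hJ₁pre hz) hpre

theorem Run.globallyOptimal (h : Run F r I ∅ xs ∅ J) :
    GloballyOptimal I F (fun x y => Neighbors I F x y ∧ xs.idxOf x < xs.idxOf y) J := by
  refine ⟨h.kept_subset_init, fun X Y _ ⟨x, hx⟩ hY hXY hcons => ?_⟩
  obtain ⟨y₁, hy₁, -⟩ := hXY x hx
  obtain ⟨y, hy, hmin⟩ := (measure (xs.idxOf ·)).wf.has_min Y ⟨y₁, hy₁⟩
  refine h.not_consistent_insert_earlier (hY hy).1 (hY hy).2 (hcons.mono ?_)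
  rintro z (rfl | ⟨hz, hzy⟩)
  · exact .inr hy
  · refine .inl ⟨hz, fun hzX => ?_⟩
    obtain ⟨y', hy', -, hlt⟩ := hXY z hzX
    exact hmin y' hy' (hlt.trans hzy)

end Order

theorem Run.isRepair (h : Run F r I ∅ xs ∅ J) : IsRepair I F J := by
  classical
  refine ⟨⟨h.kept_subset_init, h.consistent consistent_empty⟩, fun J' hJ' hle x hx => ?_⟩
  by_contra hxJ
  refine h.not_consistent_insert_earlier (hJ'.1 hx) hxJ (hJ'.2.mono ?_)
  exact Set.insert_subset hx fun z hz => hle hz.1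

theorem Run.commonOptimal (h : Run F r I ∅ xs ∅ J) (hr : IsPriority I F r) :
    CommonOptimal I F r J := by
  classical
  refine ⟨_, isTotalPriority_of_injOn h.injOn_idxOf, fun x y hxy => ?_, h.globallyOptimal⟩
  have hn := hr.neighbors x y hxy
  exact ⟨hn, h.idxOf_lt_idxOf hn.left_mem hn.right_mem hxy⟩

/-! ### Completeness -/

theorem GloballyOptimal.not_consistent_exchange (hopt : GloballyOptimal I F r J)
    (hrep : IsRepair I F J) (hx : x ∈ I) (hxJ : x ∉ J) :
    ¬ Consistent F (insert x {z ∈ J | ¬ r x z}) := by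
  intro hc
  by_cases hdom : ∃ z ∈ J, r x z
  · refine hopt.2 {z ∈ J | r x z} {x} (fun z hz => hz.1) hdom ?_ (fun z hz => ⟨x, rfl, hz.2⟩) ?_
    · exact Set.singleton_subset_iff.2 ⟨hx, hxJ⟩
    · rw [Set.union_singleton]
      exact hc.mono (Set.insert_subset_insert fun z hz => ⟨hz.1, fun hxz => hz.2 ⟨hz.1, hxz⟩⟩)
  · push Not at hdom
    rw [Set.sep_eq_self_iff_mem_true.2 hdom] at hc
    exact hxJ (hrep.le_of_ge ⟨Set.insert_subset hx hopt.1, hc⟩ (Set.subset_insert x J)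
      (Set.mem_insert x J))

theorem GloballyOptimal.not_consistent_insert_dominators (hopt : GloballyOptimal I F r J)
    (hrep : IsRepair I F J) (ht : IsTotalPriority I F r) (hx : x ∈ I) (hxJ : x ∉ J) :
    ¬ Consistent F (insert x {z ∈ J | r z x}) := by
  obtain ⟨C, hC⟩ := exists_isConflict (hopt.not_consistent_exchange hrep hx hxJ)
  have hCI : IsConflict I F C :=
    hC.mono (Set.insert_subset hx fun z hz => hopt.1 hz.1)
  have hxC : x ∈ C := by
    by_contra hxC
    refine hC.not_consistent (fun z hz => ?_) hrep.prop.2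
    rcases hC.1 hz with rfl | hz'
    exacts [absurd hz hxC, hz'.1]
  refine hC.not_consistent fun z hz => ?_
  rcases hC.1 hz with rfl | ⟨hzJ, hxz⟩
  · exact .inl rfl
  · have hne : x ≠ z := fun h => hxJ (h ▸ hzJ)
    exact .inr ⟨hzJ, (ht.comparable ⟨C, hCI, hxC, hz⟩ hne).resolve_left hxz⟩

theorem GloballyOptimal.tryInsert_eq (hopt : GloballyOptimal I F r J) (hrep : IsRepair I F J)
    (ht : IsTotalPriority I F r) (hA : A ⊆ I) (hx : x ∈ winnow r A) :
    tryInsert F (J \ A) x = J \ (A \ {x}) := by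
  by_cases hxJ : x ∈ J
  · rw [tryInsert_of_consistent (hrep.prop.2.mono (Set.insert_subset hxJ Set.sdiff_subset)),
      Set.sdiff_sdiff_right, Set.inter_eq_right.2 (Set.singleton_subset_iff.2 hxJ),
      Set.union_singleton]
  · rw [tryInsert_of_not_consistent, Set.sdiff_sdiff_right, Set.inter_singleton_eq_empty.2 hxJ,
      Set.union_empty]
    refine fun hc => hopt.not_consistent_insert_dominators hrep ht (hA hx.1) hxJ (hc.mono ?_)
    exact Set.insert_subset_insert fun z ⟨hzJ, hzx⟩ => ⟨hzJ, fun hzA => hx.2 ⟨z, hzA, hzx⟩⟩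

theorem GloballyOptimal.eq_of_run (hopt : GloballyOptimal I F r J) (hrep : IsRepair I F J)
    (ht : IsTotalPriority I F r) (hA : A ⊆ I) (h : Run F r A (J \ A) xs ∅ J') : J' = J := by
  induction xs generalizing A with
  | nil =>
    obtain ⟨rfl, rfl⟩ := run_nil_iff.1 h
    exact Set.sdiff_empty
  | cons x xs ih =>
    obtain ⟨hx, h⟩ := run_cons_iff.1 h
    exact ih (Set.sdiff_subset.trans hA) (hopt.tryInsert_eq hrep ht hA hx ▸ h)

theorem CommonOptimal.exists_run (h : CommonOptimal I F r J) (hrep : IsRepair I F J)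
    (hI : I.Finite) : ∃ xs, Run F r I ∅ xs ∅ J := by
  obtain ⟨r', ht, hext, hopt⟩ := h
  obtain ⟨xs, J', hrun⟩ := PrefRepair.exists_run (F := F) (J := ∅) ht.1.acyclic hI
  have hrun' : Run F r' I (J \ I) xs ∅ J' := by rwa [Set.sdiff_eq_empty.2 hopt.1]
  obtain rfl := hopt.eq_of_run hrep ht subset_rfl hrun'
  exact ⟨xs, hrun.of_extends hext⟩

theorem outputs_eq_cRep (hI : I.Finite) (hr : IsPriority I F r) :
    {J | ∃ xs, Execution I F r xs J} = CRep I F r := by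
  ext J
  simp only [Set.mem_ofPred_eq, execution_iff_run hI hr.acyclic]
  exact ⟨fun ⟨_, h⟩ => ⟨h.isRepair, h.commonOptimal hr⟩, fun ⟨hrep, h⟩ => h.exists_run hrep hI⟩

end Greedy

section Logic

variable {D : Type u} {Rel : Type v}

/-! ### A program logic with time bounds -/

/-- Who resolves the nondeterministic choices of a program: an adversary (`demonic`) or an ally
(`angelic`). -/
inductive Nondet where
  | demonic
  | angelic

/-- Total correctness of a configuration: it halts within time `T` in a state satisfying `Q`,
whatever transitions are taken or, in angelic mode, for suitable ones. -/
inductive Halts (m : Nondet) (Q : (ℕ → Val D Rel) → Prop) : Config D Rel → ℕ → Prop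
  | halted {σ T} (h : Q σ) : Halts m Q ([], σ) T
  | all {c T} (hex : ∃ t c', Step c t c') (ht : ∀ t c', Step c t c' → t ≤ T)
      (h : ∀ t c', Step c t c' → Halts m Q c' (T - t)) : Halts m Q c T
  | some {c t c' T} (hm : m = .angelic) (hs : Step c t c') (h : Halts m Q c' T) :
      Halts m Q c (t + T)

/-- Total correctness of the command `c` started in the state `σ`, with time bound `T` and
postcondition `Q`. -/
def Ensures (m : Nondet) (c : Cmd D Rel) (σ : ℕ → Val D Rel) (T : ℕ)
    (Q : (ℕ → Val D Rel) → Prop) : Prop :=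
  Halts m Q ([c], σ) T

variable {m : Nondet} {c c₁ c₂ P : Cmd D Rel} {b : Test D Rel} {σ : ℕ → Val D Rel}
  {B N T T' T₁ T₂ : ℕ} {Q Q' Q₁ : (ℕ → Val D Rel) → Prop} {d d' : Config D Rel} {t n : ℕ}
  {K₁ K₂ : List (Cmd D Rel)} {input out : Val D Rel}

theorem not_step_nil : ¬ Step (([], σ) : Config D Rel) t d := nofun

theorem Halts.reaches (h : Halts .demonic Q d T) (hr : Reaches d t d') :
    t ≤ T ∧ (d'.1 = [] → Q d'.2) := by
  induction hr generalizing T with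
  | refl d =>
    refine ⟨T.zero_le, fun hd => ?_⟩
    cases h with
    | halted h => exact h
    | all hex =>
      obtain ⟨K, σ⟩ := d
      obtain ⟨t, d', hs⟩ := hex
      obtain rfl : K = [] := hd
      exact absurd hs not_step_nil
    | some hm => cases hm
  | step hs _ ih =>
    cases h with
    | halted => exact absurd hs not_step_nil
    | all _ ht h =>
      obtain ⟨hle, hQ⟩ := ih (h _ _ hs)
      exact ⟨by have := ht _ _ hs; omega, hQ⟩
    | some hm => cases hm

theorem Halts.exists_reaches (h : Halts m Q d T) : ∃ t τ, Reaches d t ([], τ) ∧ Q τ := by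
  induction h with
  | halted h => exact ⟨0, _, .refl _, h⟩
  | all hex _ _ ih =>
    obtain ⟨t, d', hs⟩ := hex
    obtain ⟨t', τ, hr, hQ⟩ := ih t d' hs
    exact ⟨t + t', τ, .step hs hr, hQ⟩
  | some _ hs _ ih =>
    obtain ⟨t', τ, hr, hQ⟩ := ih
    exact ⟨_, τ, .step hs hr, hQ⟩

theorem Ensures.haltsWithin
    (h : Ensures .demonic P (Function.update (fun _ => .nil) 0 input) T Q) :
    HaltsWithin P input T :=
  fun _ _ hr => (h.reaches hr).1

theorem Ensures.of_returns {R : Val D Rel → Prop}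
    (h : Ensures .demonic P (Function.update (fun _ => .nil) 0 input) T fun τ => R (τ 0))
    (hr : Returns P input out) : R out := by
  obtain ⟨t, σ, hr, rfl⟩ := hr
  exact (h.reaches hr).2 rfl

theorem Ensures.exists_returns
    (h : Ensures m P (Function.update (fun _ => .nil) 0 input) T Q) :
    ∃ τ, Q τ ∧ Returns P input (τ 0) := by
  obtain ⟨t, τ, hr, hQ⟩ := Halts.exists_reaches h
  exact ⟨τ, hQ, t, τ, hr, rfl⟩

theorem Halts.mono (h : Halts m Q d T) (hT : T ≤ T') (hQ : ∀ τ, Q τ → Q' τ) :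
    Halts m Q' d T' := by
  induction h generalizing T' with
  | halted h => exact .halted (hQ _ h)
  | all hex ht _ ih =>
    exact .all hex (fun t d' hs => (ht t d' hs).trans hT)
      fun t d' hs => ih t d' hs (Nat.sub_le_sub_right hT t)
  | @some _ t _ _ hm hs _ ih =>
    have h := Halts.some hm hs (ih (Nat.le_sub_of_add_le' hT))
    rwa [Nat.add_sub_cancel' ((Nat.le_add_right _ _).trans hT)] at h

theorem Ensures.mono (h : Ensures m c σ T Q) (hT : T ≤ T') (hQ : ∀ τ, Q τ → Q' τ) :
    Ensures m c σ T' Q' :=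
  Halts.mono h hT hQ

theorem Halts.of_step (hs : Step d t d') (huniq : ∀ s e, Step d s e → s = t ∧ e = d')
    (h : Halts m Q d' T) (hT : t + T ≤ T') : Halts m Q d T' := by
  refine .all ⟨t, d', hs⟩ (fun s e hse => ?_) fun s e hse => ?_
  all_goals obtain ⟨rfl, rfl⟩ := huniq s e hse
  · exact (Nat.le_add_right _ _).trans hT
  · exact h.mono (Nat.le_sub_of_add_le' hT) fun _ => id

theorem Step.append (h : Step (K₁, σ) t d) : Step (K₁ ++ K₂, σ) t (d.1 ++ K₂, d.2) := by
  cases h <;> constructor <;> assumption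

theorem Step.exists_of_append (hK : K₁ ≠ []) (h : Step (K₁ ++ K₂, σ) t d) :
    ∃ d', Step (K₁, σ) t d' ∧ d = (d'.1 ++ K₂, d'.2) := by
  obtain ⟨c, K, rfl⟩ := List.exists_cons_of_ne_nil hK
  rw [List.cons_append] at h
  cases h
  exacts [⟨_, .skip _ _, rfl⟩, ⟨_, .assign _ _ _ _, rfl⟩, ⟨_, .seq _ _ _ _, rfl⟩,
    ⟨_, .ite_true _ _ _ _ _ ‹_›, rfl⟩, ⟨_, .ite_false _ _ _ _ _ ‹_›, rfl⟩,
    ⟨_, .loop_true _ _ _ _ ‹_›, rfl⟩, ⟨_, .loop_false _ _ _ _ ‹_›, rfl⟩,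
    ⟨_, .choose_left _ _ _ _, rfl⟩, ⟨_, .choose_right _ _ _ _, rfl⟩]

theorem Halts.append (h₁ : Halts m Q₁ (K₁, σ) T₁) (h₂ : ∀ τ, Q₁ τ → Halts m Q (K₂, τ) T₂) :
    Halts m Q (K₁ ++ K₂, σ) (T₁ + T₂) := by
  generalize hd : (K₁, σ) = d at h₁
  induction h₁ generalizing K₁ σ with
  | halted h =>
    obtain ⟨rfl, rfl⟩ := Prod.mk.inj hd
    exact (h₂ _ h).mono (Nat.le_add_left _ _) fun _ => id
  | @all _ T₁ hex ht _ ih =>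
    subst hd
    obtain ⟨t, d', hs⟩ := hex
    have hK : K₁ ≠ [] := by
      rintro rfl
      exact not_step_nil hs
    refine .all ⟨t, _, hs.append⟩ (fun t d hs => ?_) fun t d hs => ?_
    all_goals obtain ⟨d', hs', rfl⟩ := hs.exists_of_append hK
    · exact (ht t d' hs').trans (Nat.le_add_right _ _)
    · exact (ih t d' hs' rfl).mono (by have := ht t d' hs'; omega) fun _ => id
  | some hm hs _ ih =>
    subst hd
    rw [add_assoc]
    exact .some hm hs.append (ih rfl)

/-- The register `n` is assigned to in the command. -/
def Cmd.Writes (n : ℕ) : Cmd D Rel → Prop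
  | .skip => False
  | .assign k _ => n = k
  | .seq c₁ c₂ => c₁.Writes n ∨ c₂.Writes n
  | .ite _ c₁ c₂ => c₁.Writes n ∨ c₂.Writes n
  | .loop _ c => c.Writes n
  | .choose c₁ c₂ => c₁.Writes n ∨ c₂.Writes n

theorem Step.frame (h : Step d t d') (hn : ∀ c ∈ d.1, ¬ c.Writes n) :
    (∀ c ∈ d'.1, ¬ c.Writes n) ∧ d'.2 n = d.2 n := by
  cases h <;> simp_all [Cmd.Writes, Function.update_of_ne]

theorem Halts.frame {W : Set ℕ} (h : Halts m Q d T)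
    (hW : ∀ n ∈ W, (∀ c ∈ d.1, ¬ c.Writes n) ∧ d.2 n = σ n) :
    Halts m (fun τ => Q τ ∧ ∀ n ∈ W, τ n = σ n) d T := by
  have hstep : ∀ {d d' : Config D Rel} {t},
      (∀ n ∈ W, (∀ c ∈ d.1, ¬ c.Writes n) ∧ d.2 n = σ n) → Step d t d' →
      ∀ n ∈ W, (∀ c ∈ d'.1, ¬ c.Writes n) ∧ d'.2 n = σ n := fun hW hs n hn => by
    obtain ⟨hw, heq⟩ := hs.frame (hW n hn).1
    exact ⟨hw, heq.trans (hW n hn).2⟩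
  induction h with
  | halted h => exact .halted ⟨h, fun n hn => (hW n hn).2⟩
  | all hex ht _ ih => exact .all hex ht fun t d' hs => ih t d' hs (hstep hW hs)
  | some hm hs _ ih => exact .some hm hs (ih (hstep hW hs))

theorem Ensures.frame (h : Ensures m c σ T Q) :
    Ensures m c σ T fun τ => Q τ ∧ ∀ n, ¬ c.Writes n → τ n = σ n :=
  Halts.frame (W := {n | ¬ c.Writes n}) h fun n hn => ⟨by simpa using hn, rfl⟩

theorem Ensures.skip (hT : 1 ≤ T) (h : Q σ) : Ensures m .skip σ T Q :=
  .of_step (.skip _ _) (by rintro _ _ ⟨⟩; exact ⟨rfl, rfl⟩) (.halted (T := 0) h) hT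

theorem Ensures.assign {e : Expr D Rel} (hT : e.cost + 1 ≤ T)
    (h : Q (Function.update σ n (e.eval σ))) : Ensures m (.assign n e) σ T Q :=
  .of_step (.assign _ _ _ _) (by rintro _ _ ⟨⟩; exact ⟨rfl, rfl⟩) (.halted (T := 0) h) hT

theorem Ensures.seq (h₁ : Ensures m c₁ σ T₁ Q₁)
    (h₂ : ∀ τ, Q₁ τ → (∀ n, ¬ c₁.Writes n → τ n = σ n) → Ensures m c₂ τ T₂ Q)
    (hT : T₁ + T₂ + 1 ≤ T) : Ensures m (.seq c₁ c₂) σ T Q :=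
  .of_step (.seq _ _ _ _) (by rintro _ _ ⟨⟩; exact ⟨rfl, rfl⟩)
    (Halts.append h₁.frame fun τ hτ => h₂ τ hτ.1 hτ.2) (by omega)

theorem Ensures.assign_seq {e : Expr D Rel}
    (h : Ensures m c (Function.update σ n (e.eval σ)) T₁ Q) (hT : e.cost + 2 + T₁ ≤ T) :
    Ensures m (.seq (.assign n e) c) σ T Q := by
  refine .seq (T₁ := e.cost + 1) (T₂ := T₁) (.assign le_rfl (Q := fun τ => τ = _) rfl) ?_ (by omega)
  rintro τ rfl -
  exact h

theorem Ensures.ite (h₁ : b.Holds σ → Ensures m c₁ σ T₁ Q)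
    (h₂ : ¬ b.Holds σ → Ensures m c₂ σ T₁ Q) (hT : b.cost σ + 1 + T₁ ≤ T) :
    Ensures m (.ite b c₁ c₂) σ T Q := by
  by_cases hb : b.Holds σ
  · exact .of_step (.ite_true _ _ _ _ _ hb) (by rintro _ _ ⟨⟩ <;> simp_all) (h₁ hb) hT
  · exact .of_step (.ite_false _ _ _ _ _ hb) (by rintro _ _ ⟨⟩ <;> simp_all) (h₂ hb) hT

theorem Ensures.loop_true (hb : b.Holds σ) (h₁ : Ensures m c σ T₁ Q₁)
    (h₂ : ∀ τ, Q₁ τ → Ensures m (.loop b c) τ T₂ Q) (hT : b.cost σ + 1 + (T₁ + T₂) ≤ T) :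
    Ensures m (.loop b c) σ T Q :=
  .of_step (.loop_true _ _ _ _ hb) (by rintro _ _ ⟨⟩ <;> simp_all) (Halts.append h₁ h₂) hT

theorem Ensures.loop_false (hb : ¬ b.Holds σ) (h : Q σ) (hT : b.cost σ + 1 ≤ T) :
    Ensures m (.loop b c) σ T Q :=
  .of_step (.loop_false _ _ _ _ hb) (by rintro _ _ ⟨⟩ <;> simp_all) (.halted (T := 0) h) hT

theorem Ensures.choose (h₁ : Ensures m c₁ σ T₁ Q) (h₂ : Ensures m c₂ σ T₁ Q)
    (hT : T₁ + 1 ≤ T) : Ensures m (.choose c₁ c₂) σ T Q := by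
  refine .all ⟨_, _, .choose_left _ _ _ _⟩ ?_ ?_
  · rintro _ _ ⟨⟩ <;> exact (Nat.le_add_left _ _).trans hT
  · rintro _ _ ⟨⟩
    exacts [h₁.mono (by omega) fun _ => id, h₂.mono (by omega) fun _ => id]

theorem Ensures.choose_left (h₁ : Ensures .angelic c₁ σ T₁ Q) (hT : T₁ + 1 ≤ T) :
    Ensures .angelic (.choose c₁ c₂) σ T Q :=
  (Halts.some rfl (.choose_left _ _ _ _) h₁).mono (by omega) fun _ => id

theorem Ensures.choose_right (h₂ : Ensures .angelic c₂ σ T₁ Q) (hT : T₁ + 1 ≤ T) :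
    Ensures .angelic (.choose c₁ c₂) σ T Q :=
  (Halts.some rfl (.choose_right _ _ _ _) h₂).mono (by omega) fun _ => id

theorem Ensures.loop {Inv : ℕ → (ℕ → Val D Rel) → Prop}
    (hstep : ∀ n σ, Inv (n + 1) σ → b.Holds σ ∧ b.cost σ ≤ B ∧ Ensures m c σ T (Inv n))
    (hzero : ∀ σ, Inv 0 σ → ¬ b.Holds σ ∧ b.cost σ ≤ B) (h : Inv n σ) :
    Ensures m (.loop b c) σ (n * (T + B + 1) + B + 1) (Inv 0) := by
  induction n generalizing σ with
  | zero =>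
    obtain ⟨hb, hB⟩ := hzero σ h
    exact .loop_false hb h (by omega)
  | succ n ih =>
    obtain ⟨hb, hB, hbody⟩ := hstep n σ h
    refine .loop_true hb hbody (fun τ hτ => ih hτ) ?_
    rw [Nat.succ_mul]
    omega

/-! ### Iteration over lists -/

/-- Run `body` on each element of the list `src`. During the iteration the register `i` holds the
list of the elements that are still to be treated, the current one at its head. -/
def Cmd.forEach (i : ℕ) (src : Expr D Rel) (body : Cmd D Rel) : Cmd D Rel :=
  .seq (.assign i src)
    (.loop (.not (.isNil (.reg i))) (.seq body (.assign i (.tl (.reg i)))))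

theorem Cmd.writes_forEach {i : ℕ} {src : Expr D Rel} {body : Cmd D Rel} :
    (Cmd.forEach i src body).Writes n ↔ n = i ∨ body.Writes n := by
  simp only [forEach, Writes]
  tauto

theorem Val.ofList_eq_nil_iff {l : List (Val D Rel)} : Val.ofList l = .nil ↔ l = [] := by
  cases l <;> simp [Val.ofList]

theorem Ensures.forEach {α : Type*} {enc : α → Val D Rel} {i : ℕ} {src : Expr D Rel}
    {body : Cmd D Rel} {l : List α} {Inv : List α → (ℕ → Val D Rel) → Prop}
    (hsrc : src.eval σ = .ofList (l.map enc)) (hlen : l.length ≤ N) (hi : ¬ body.Writes i)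
    (hInv : ∀ pre τ v, Inv pre τ → Inv pre (Function.update τ i v)) (hinit : Inv [] σ)
    (hstep : ∀ pre a post τ, l = pre ++ a :: post → τ i = .ofList ((a :: post).map enc) →
      (∀ n, ¬ (Cmd.forEach i src body).Writes n → τ n = σ n) → Inv pre τ →
      Ensures m body τ T (Inv (pre ++ [a]))) :
    Ensures m (Cmd.forEach i src body) σ (N * (T + 8) + src.cost + 6) (Inv l) := by
  let R : ℕ → (ℕ → Val D Rel) → Prop := fun k τ =>
    ∃ pre post, l = pre ++ post ∧ post.length = k ∧ τ i = .ofList (post.map enc) ∧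
      (∀ n, ¬ (Cmd.forEach i src body).Writes n → τ n = σ n) ∧ Inv pre τ
  have hloop : Ensures m (.loop (.not (.isNil (.reg i))) (.seq body (.assign i (.tl (.reg i)))))
      (Function.update σ i (.ofList (l.map enc))) (l.length * (T + 4 + 3 + 1) + 3 + 1) (R 0) := by
    refine .loop (T := T + 4) (B := 3) (Inv := R) ?_ ?_ ?_
    · rintro k τ ⟨pre, post, hl, hk, hτ, hfr, hinv⟩
      obtain ⟨a, post, rfl⟩ := List.exists_cons_of_length_eq_add_one hk
      refine ⟨by simp [Test.Holds, Expr.eval, hτ, Val.ofList], by simp [Test.cost, Expr.cost], ?_⟩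
      refine .seq (hstep pre a post τ hl hτ hfr hinv) (T₂ := 3) (fun τ' hinv' hfr' => ?_) (by omega)
      have htl : (Expr.tl (.reg i) : Expr D Rel).eval τ' = .ofList (post.map enc) := by
        simp [Expr.eval, hfr' i hi, hτ, Val.ofList, Val.tl]
      refine .assign (by simp [Expr.cost]) ⟨pre ++ [a], post, by simp [hl], by simpa using hk,
        by simp [htl], fun n hn => ?_, hInv _ _ _ hinv'⟩
      obtain ⟨hni, hnb⟩ := not_or.1 (mt Cmd.writes_forEach.2 hn)
      rw [Function.update_of_ne hni, hfr' n hnb, hfr n hn]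
    · rintro τ ⟨pre, post, -, hk, hτ, -⟩
      obtain rfl := List.length_eq_zero_iff.1 hk
      simp [Test.Holds, Test.cost, Expr.eval, Expr.cost, hτ, Val.ofList]
    · exact ⟨[], l, rfl, rfl, Function.update_self .., fun n hn =>
        Function.update_of_ne (fun h => hn (Cmd.writes_forEach.2 (.inl h))) .., hInv _ _ _ hinit⟩
  have htime : l.length * (T + 4 + 3 + 1) ≤ N * (T + 8) := Nat.mul_le_mul_right _ hlen
  refine .assign_seq (T₁ := N * (T + 8) + 4) (hsrc ▸ hloop.mono (by omega) ?_) (by omega)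
  rintro τ ⟨pre, post, hl, hk, -, -, hinv⟩
  obtain rfl := List.length_eq_zero_iff.1 hk
  rwa [hl, List.append_nil]

/-- Raise the flag `k`, that is make it different from the empty list, if `b` holds. -/
def Cmd.raiseIf (b : Test D Rel) (k : ℕ) : Cmd D Rel :=
  .ite b (.assign k (.cons .nil .nil)) .skip

theorem Ensures.raiseIf {k : ℕ} (hB : b.cost σ ≤ B) :
    Ensures m (Cmd.raiseIf b k) σ (B + 5) fun τ => τ k ≠ .nil ↔ σ k ≠ .nil ∨ b.Holds σ := by
  refine .ite (T₁ := 4) (fun hb => .assign (by simp [Expr.cost]) ?_)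
    (fun hb => .skip (by omega) ?_) (by omega) <;> simp [hb, Expr.eval]

theorem Ensures.search {α : Type*} {enc : α → Val D Rel} {φ : α → Prop} {i k : ℕ}
    {src : Expr D Rel} {body : Cmd D Rel} {l : List α}
    (hsrc : src.eval σ = .ofList (l.map enc)) (hlen : l.length ≤ N) (hi : ¬ body.Writes i)
    (hki : k ≠ i)
    (hstep : ∀ a ∈ l, ∀ τ, (τ i).hd = enc a →
      (∀ n, ¬ (Cmd.forEach i src body).Writes n → τ n = σ n) →
      Ensures m body τ T fun τ' => τ' k ≠ .nil ↔ τ k ≠ .nil ∨ φ a) :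
    Ensures m (Cmd.forEach i src body) σ (N * (T + 8) + src.cost + 6)
      fun τ => τ k ≠ .nil ↔ σ k ≠ .nil ∨ ∃ a ∈ l, φ a := by
  refine .forEach (Inv := fun pre τ => τ k ≠ .nil ↔ σ k ≠ .nil ∨ ∃ a ∈ pre, φ a)
    hsrc hlen hi (fun pre τ v h => ?_) (by simp) fun pre a post τ hl hτ hfr hinv => ?_
  · rwa [Function.update_of_ne hki]
  · refine (hstep a (by simp [hl]) τ (by simp [hτ, Val.ofList, Val.hd]) hfr).mono le_rfl ?_
    intro τ' hτ'
    rw [hτ', hinv, or_assoc]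
    simp only [List.mem_append, List.mem_singleton, or_and_right, exists_or, exists_eq_left]

/-- Collect in the register `dst`, in reverse order, the elements of the list `src` that pass the
test `b` after the command `c` has been run on them. -/
def Cmd.filter (i dst : ℕ) (src : Expr D Rel) (c : Cmd D Rel) (b : Test D Rel) : Cmd D Rel :=
  .seq (.assign dst .nil)
    (.forEach i src (.seq c (.ite b (.assign dst (.cons (.hd (.reg i)) (.reg dst))) .skip)))

theorem Cmd.writes_filter {i dst : ℕ} {src : Expr D Rel} :
    (Cmd.filter i dst src c b).Writes n ↔ n = dst ∨ n = i ∨ c.Writes n := by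
  simp only [filter, Writes, writes_forEach]
  tauto

theorem Ensures.filter {α : Type*} {enc : α → Val D Rel} {φ : α → Prop} [DecidablePred φ]
    {i dst : ℕ} {src : Expr D Rel} {l : List α}
    (hsrc : src.eval (Function.update σ dst .nil) = .ofList (l.map enc)) (hlen : l.length ≤ N)
    (hi : ¬ c.Writes i) (hdst : ¬ c.Writes dst) (hne : dst ≠ i)
    (hstep : ∀ a ∈ l, ∀ τ, (τ i).hd = enc a →
      (∀ n, ¬ (Cmd.filter i dst src c b).Writes n → τ n = σ n) →
      Ensures m c τ T fun τ' => (b.Holds τ' ↔ φ a) ∧ b.cost τ' ≤ B) :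
    Ensures m (Cmd.filter i dst src c b) σ (N * (T + B + 7 + 8) + src.cost + 9)
      fun τ => τ dst = .ofList ((l.filter φ).reverse.map enc) := by
  refine .assign_seq (T₁ := N * (T + B + 7 + 8) + src.cost + 6)
    (.forEach (Inv := fun pre τ => τ dst = .ofList ((pre.filter φ).reverse.map enc))
      hsrc hlen (by simp [Cmd.Writes, hi, hne.symm]) (fun pre τ v h => ?_)
      (Function.update_self ..) fun pre a post τ hl hτ hfr hinv => ?_)
    (by simp only [Expr.cost]; omega)
  · rwa [Function.update_of_ne hne]
  have hhd : (τ i).hd = enc a := by simp [hτ, Val.ofList, Val.hd]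
  have hframe : ∀ n, ¬ (Cmd.filter i dst src c b).Writes n → τ n = σ n := fun n hn => by
    obtain ⟨hn₁, hn₂⟩ := not_or.1 hn
    rw [hfr n hn₂, Function.update_of_ne hn₁]
  refine .seq (T₂ := B + 6) (hstep a (by simp [hl]) τ hhd hframe) (fun τ' ⟨hb, _⟩ hfr' => ?_)
    (by omega)
  refine .ite (T₁ := 5) (fun h => .assign (by simp [Expr.cost]) ?_)
    (fun h => .skip (by omega) ?_) (by omega)
  · simp [List.filter_append, hb.1 h, Expr.eval, hfr' i hi, hhd, hfr' dst hdst, hinv, Val.ofList]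
  · simp [List.filter_append, mt hb.2 h, hfr' dst hdst, hinv]

end Logic

section Check

variable {D : Type u} {Rel : Type v} {S : Schema Rel} {σ : ℕ → Val D Rel}
  {g : ℕ → DBFact D S} {ρ : Var → Const D}

/-! ### Testing a constraint -/

@[simp]
theorem Val.hd_cons (a b : Val D Rel) : (Val.cons a b).hd = a := rfl

@[simp]
theorem Val.tl_cons (a b : Val D Rel) : (Val.cons a b).tl = b := rfl

/-- The expression for the `k`-th entry of the list denoted by an expression. -/
def Expr.nth : ℕ → Expr D Rel → Expr D Rel
  | 0, e => .hd e
  | k + 1, e => (Expr.tl e).nth k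

theorem Expr.eval_nth {l : List (Val D Rel)} {k : ℕ} {v : Val D Rel} {e : Expr D Rel}
    (he : e.eval σ = .ofList l) (hk : l[k]? = some v) : (e.nth k).eval σ = v := by
  induction k generalizing e l with
  | zero =>
    obtain ⟨l, rfl⟩ : ∃ l', l = v :: l' := by cases l <;> simp_all
    simp [nth, eval, he, Val.ofList]
  | succ k ih =>
    cases l with
    | nil => simp at hk
    | cons a l => exact ih (l := l) (by simp [eval, he, Val.ofList]) (by simpa using hk)

/-- The conjunction of a list of tests. -/
def Test.conj : List (Test D Rel) → Test D Rel
  | [] => .isNil .nil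
  | b :: bs => .and b (Test.conj bs)

theorem Test.holds_conj {bs : List (Test D Rel)} :
    (Test.conj bs).Holds σ ↔ ∀ b ∈ bs, b.Holds σ := by
  induction bs with
  | nil => simp [conj, Holds, Expr.eval]
  | cons b bs ih => simp [conj, Holds, ih]

/-- The facts being tested sit at the heads of the registers `20, 21, …`: those with an index in
`s` form the family `g`. -/
def Loaded (s : Set ℕ) (g : ℕ → DBFact D S) (σ : ℕ → Val D Rel) : Prop :=
  ∀ j ∈ s, (σ (20 + j)).hd = (g j).encode

/-- The expression for the `k`-th argument of the fact at the head of register `20 + j`. -/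
def argExpr (j k : ℕ) : Expr D Rel :=
  (Expr.tl (.hd (.reg (20 + j)))).nth k

theorem eval_argExpr {f : DBFact D S} {d : Const D} {j k : ℕ} (h : (σ (20 + j)).hd = f.encode)
    (hk : f.args[k]? = some d) : (argExpr j k).eval σ = .const d :=
  Expr.eval_nth (l := f.args.map .const) (by simp [Expr.eval, h, DBFact.encode]) (by simp [hk])

/-- The variable `x` is the argument with index `p.2` of the atom with index `p.1`. -/
def OccursAt (atoms : List (RelAtom S)) (x : Var) (p : ℕ × ℕ) : Prop :=
  ∃ a, atoms[p.1]? = some a ∧ a.vars[p.2]? = some x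

/-- The position at which a test reads the value of `x`; arbitrary if `x` does not occur. -/
noncomputable def occurrence (atoms : List (RelAtom S)) (x : Var) : ℕ × ℕ :=
  Classical.epsilon (OccursAt atoms x)

theorem occursAt_occurrence {atoms : List (RelAtom S)} {a : RelAtom S} {x : Var} (ha : a ∈ atoms)
    (hx : x ∈ a.vars) : OccursAt atoms x (occurrence atoms x) := by
  obtain ⟨j, hj⟩ := List.mem_iff_getElem?.1 ha
  obtain ⟨k, hk⟩ := List.mem_iff_getElem?.1 hx
  exact Classical.epsilon_spec (p := OccursAt atoms x) ⟨(j, k), a, hj, hk⟩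

/-- The expression for the value of a variable under the substitution that matches the atoms with
the facts being tested. -/
noncomputable def varExpr (atoms : List (RelAtom S)) (x : Var) : Expr D Rel :=
  argExpr (occurrence atoms x).1 (occurrence atoms x).2

/-- The compilation of a term, given expressions for the values of the variables. -/
def Term.toExpr (val : Var → Expr D Rel) : Term D → Expr D Rel
  | .var x => val x
  | .const c => .const c

theorem Term.eval_toExpr {val : Var → Expr D Rel} {t : Term D}
    (h : ∀ x, t.HasVar x → (val x).eval σ = .const (ρ x)) :
    (t.toExpr val).eval σ = .const (t.eval ρ) := by
  cases t with
  | var x => exact h x rfl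
  | const c => rfl

/-- The compilation of a formula, given expressions for the values of the variables. -/
def Formula.toTest (val : Var → Expr D Rel) : Formula D → Test D Rel
  | .tru => .isNil .nil
  | .cmp op s t => .cmp op (s.toExpr val) (t.toExpr val)
  | .not φ => .not (φ.toTest val)
  | .and φ ψ => .and (φ.toTest val) (ψ.toTest val)
  | .or φ ψ => .or (φ.toTest val) (ψ.toTest val)

theorem Formula.holds_toTest {val : Var → Expr D Rel} {φ : Formula D}
    (h : ∀ x, φ.HasVar x → (val x).eval σ = .const (ρ x)) :
    (φ.toTest val).Holds σ ↔ φ.Holds ρ := by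
  induction φ with
  | tru => simp [toTest, Test.Holds, Holds, Expr.eval]
  | cmp op s t =>
    rw [toTest, Test.Holds, Term.eval_toExpr fun x hx => h x (.inl hx),
      Term.eval_toExpr fun x hx => h x (.inr hx)]
    simp [Holds]
  | not φ ih => rw [toTest, Test.Holds, ih h, Holds]
  | and φ ψ ih₁ ih₂ =>
    rw [toTest, Test.Holds, ih₁ fun x hx => h x (.inl hx), ih₂ fun x hx => h x (.inr hx), Holds]
  | or φ ψ ih₁ ih₂ =>
    rw [toTest, Test.Holds, ih₁ fun x hx => h x (.inl hx), ih₂ fun x hx => h x (.inr hx), Holds]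

/-- The test whether the fact at the head of register `20 + j` is an instance of an atom, given
expressions for the values of the variables. -/
def RelAtom.toTest (val : Var → Expr D Rel) (a : RelAtom S) (j : ℕ) : Test D Rel :=
  .and (.same (.hd (.hd (.reg (20 + j)))) (.rel a.rel))
    (.conj (a.vars.zipIdx.map fun p => .cmp .eq (argExpr j p.2) (val p.1)))

theorem RelAtom.rel_eq_of_holds_toTest {val : Var → Expr D Rel} {a : RelAtom S} {f : DBFact D S}
    {j : ℕ} (hf : (σ (20 + j)).hd = f.encode) (h : (a.toTest val j).Holds σ) : f.rel = a.rel := by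
  simpa [toTest, Test.Holds, Expr.eval, hf, DBFact.encode] using h.1

theorem RelAtom.length_args {a : RelAtom S} {f : DBFact D S} (h : f.rel = a.rel) :
    f.args.length = a.vars.length := by
  rw [← List.length_map (f := Const.kind), f.typed, h, ← a.typed, List.length_map]

theorem RelAtom.holds_toTest {val : Var → Expr D Rel} {a : RelAtom S} {f : DBFact D S} {j : ℕ}
    (hf : (σ (20 + j)).hd = f.encode)
    (hval : ∀ x ∈ a.vars, (val x).eval σ = .const (ρ x)) :
    (a.toTest val j).Holds σ ↔ a.Matches ρ f := by
  have hrel : (Test.same (.hd (.hd (.reg (20 + j)))) (.rel a.rel)).Holds σ ↔ f.rel = a.rel := by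
    simp [Test.Holds, Expr.eval, hf, DBFact.encode]
  rw [toTest, Test.Holds, hrel, Matches, and_congr_right_iff]
  intro hr
  have hlen := RelAtom.length_args hr
  simp only [Test.holds_conj, List.forall_mem_map, Prod.forall, List.mem_zipIdx_iff_getElem?]
  have harg : ∀ k x, a.vars[k]? = some x →
      ((Test.cmp .eq (argExpr j k) (val x)).Holds σ ↔ f.args[k]? = some (ρ x)) := by
    intro k x hx
    have hk : k < f.args.length := hlen ▸ (List.getElem?_eq_some_iff.1 hx).1
    simp [Test.Holds, eval_argExpr hf (List.getElem?_eq_getElem hk),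
      hval x (List.mem_of_getElem? hx), Cmp.Holds, List.getElem?_eq_getElem hk]
  constructor
  · intro h
    refine List.ext_getElem (by simpa using hlen) fun k hk hk' => ?_
    have hx := List.getElem?_eq_getElem (hlen ▸ hk)
    obtain ⟨_, heq⟩ := List.getElem?_eq_some_iff.1 ((harg k _ hx).1 (h _ k hx))
    simpa using heq
  · exact fun h x k hx => (harg k x hx).2 (by simp [h, hx])

/-- The test whether the facts at the heads of the registers from `20` on violate a constraint. -/
noncomputable def DenialConstraint.toTest (c : DenialConstraint D S) : Test D Rel :=
  .and (.conj (c.atoms.zipIdx.map fun p => p.1.toTest (varExpr c.atoms) p.2))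
    (c.cond.toTest (varExpr c.atoms))

/-- The facts `g 0, g 1, …` match the atoms of the constraint in this order and satisfy its
condition. -/
def DenialConstraint.ViolatedBy (c : DenialConstraint D S) (g : ℕ → DBFact D S) : Prop :=
  ∃ ρ : Var → Const D, (∀ (j : ℕ) a, c.atoms[j]? = some a → a.Matches ρ (g j)) ∧ c.cond.Holds ρ

theorem DenialConstraint.holds_toTest_of_eval {c : DenialConstraint D S}
    (hg : Loaded (Set.Iio c.atoms.length) g σ)
    (hval : ∀ a ∈ c.atoms, ∀ x ∈ a.vars, (varExpr c.atoms x).eval σ = .const (ρ x)) :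
    c.toTest.Holds σ ↔
      (∀ (j : ℕ) a, c.atoms[j]? = some a → a.Matches ρ (g j)) ∧ c.cond.Holds ρ := by
  have hcond : (c.cond.toTest (varExpr c.atoms)).Holds σ ↔ c.cond.Holds ρ :=
    Formula.holds_toTest fun x hx => by
      obtain ⟨a, ha, hxa⟩ := c.safe x hx
      exact hval a ha x hxa
  have hatom : ∀ (j : ℕ) a, c.atoms[j]? = some a →
      ((a.toTest (varExpr c.atoms) j).Holds σ ↔ a.Matches ρ (g j)) := fun j a hj =>
    RelAtom.holds_toTest (hg j (List.getElem?_eq_some_iff.1 hj).1)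
      (hval a (List.mem_of_getElem? hj))
  rw [toTest, Test.Holds, hcond, Test.holds_conj]
  simp only [List.forall_mem_map, Prod.forall, List.mem_zipIdx_iff_getElem?]
  exact and_congr_left' ⟨fun h j a hj => (hatom j a hj).1 (h a j hj),
    fun h a j hj => (hatom j a hj).2 (h j a hj)⟩

theorem eval_varExpr {atoms : List (RelAtom S)} {a : RelAtom S} {x : Var} {d : Const D}
    (hg : Loaded (Set.Iio atoms.length) g σ) (ha : a ∈ atoms) (hx : x ∈ a.vars)
    (hd : (g (occurrence atoms x).1).args[(occurrence atoms x).2]? = some d) :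
    (varExpr atoms x).eval σ = .const d := by
  obtain ⟨b, hb, -⟩ := occursAt_occurrence ha hx
  exact eval_argExpr (hg _ (List.getElem?_eq_some_iff.1 hb).1) hd

theorem DenialConstraint.holds_toTest {c : DenialConstraint D S}
    (hg : Loaded (Set.Iio c.atoms.length) g σ) : c.toTest.Holds σ ↔ c.ViolatedBy g := by
  constructor
  · intro h
    have hrel : ∀ (j : ℕ) a, c.atoms[j]? = some a → (g j).rel = a.rel := fun j a hj =>
      RelAtom.rel_eq_of_holds_toTest (hg j (List.getElem?_eq_some_iff.1 hj).1)
        (Test.holds_conj.1 h.1 _ (List.mem_map.2 ⟨(a, j), List.mem_zipIdx_iff_getElem?.2 hj, rfl⟩))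
    -- The substitution is read off the facts, at one occurrence of each variable.
    let ρ : Var → Const D := fun x =>
      ((g (occurrence c.atoms x).1).args[(occurrence c.atoms x).2]?).getD (.num 0)
    refine ⟨ρ, (holds_toTest_of_eval hg fun a ha x hx => eval_varExpr hg ha hx ?_).1 h⟩
    obtain ⟨b, hb, hbx⟩ := occursAt_occurrence ha hx
    have hk : (occurrence c.atoms x).2 < (g (occurrence c.atoms x).1).args.length := by
      rw [RelAtom.length_args (hrel _ b hb)]
      exact (List.getElem?_eq_some_iff.1 hbx).1
    simp [ρ, List.getElem?_eq_getElem hk]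
  · rintro ⟨ρ, hatoms, hcond⟩
    refine (holds_toTest_of_eval hg fun a ha x hx => eval_varExpr hg ha hx ?_).2 ⟨hatoms, hcond⟩
    obtain ⟨b, hb, hbx⟩ := occursAt_occurrence ha hx
    rw [(hatoms _ b hb).2, List.getElem?_map, hbx, Option.map_some]

/-- The test takes bounded time on the states that satisfy `p`. -/
def Test.BoundedCost (p : (ℕ → Val D Rel) → Prop) (b : Test D Rel) : Prop :=
  ∃ C, ∀ σ, p σ → b.cost σ ≤ C

theorem Test.BoundedCost.and {p : (ℕ → Val D Rel) → Prop} {b₁ b₂ : Test D Rel}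
    (h₁ : b₁.BoundedCost p) (h₂ : b₂.BoundedCost p) : (Test.and b₁ b₂).BoundedCost p := by
  obtain ⟨C₁, h₁⟩ := h₁
  obtain ⟨C₂, h₂⟩ := h₂
  exact ⟨C₁ + C₂ + 1, fun σ hσ => Nat.succ_le_succ (add_le_add (h₁ σ hσ) (h₂ σ hσ))⟩

theorem Test.BoundedCost.conj {p : (ℕ → Val D Rel) → Prop} {bs : List (Test D Rel)}
    (h : ∀ b ∈ bs, b.BoundedCost p) : (Test.conj bs).BoundedCost p := by
  induction bs with
  | nil => exact ⟨_, fun _ _ => le_rfl⟩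
  | cons b bs ih => exact .and (h b (by simp)) (ih fun b hb => h b (by simp [hb]))

theorem Formula.boundedCost_toTest (p : (ℕ → Val D Rel) → Prop) (val : Var → Expr D Rel)
    (φ : Formula D) : (φ.toTest val).BoundedCost p := by
  induction φ with
  | tru | cmp => exact ⟨_, fun _ _ => le_rfl⟩
  | not φ ih =>
    obtain ⟨C, hC⟩ := ih
    exact ⟨C + 1, fun σ hσ => Nat.succ_le_succ (hC σ hσ)⟩
  | and φ ψ ih₁ ih₂ | or φ ψ ih₁ ih₂ => exact ih₁.and ih₂

theorem RelAtom.boundedCost_toTest (val : Var → Expr D Rel) (a : RelAtom S) (j : ℕ) :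
    (a.toTest val j).BoundedCost fun σ => ∃ g : ℕ → DBFact D S, Loaded {j} g σ := by
  refine .and ⟨7, ?_⟩ (.conj ?_)
  · rintro σ ⟨g, hg⟩
    have hrel : (σ (20 + j)).hd.hd = .rel (g j).rel := by rw [hg j rfl]; rfl
    simp [Test.cost, Expr.cost, Expr.eval, hrel, Val.size]
  · simp only [List.forall_mem_map]
    exact fun _ _ => ⟨_, fun _ _ => le_rfl⟩

theorem DenialConstraint.boundedCost_toTest (c : DenialConstraint D S) :
    c.toTest.BoundedCost fun σ =>
      ∃ g : ℕ → DBFact D S, Loaded (Set.Iio c.atoms.length) g σ := by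
  refine .and (.conj ?_) (Formula.boundedCost_toTest _ _ _)
  simp only [List.forall_mem_map, Prod.forall, List.mem_zipIdx_iff_getElem?]
  intro a j hj
  obtain ⟨C, hC⟩ := a.boundedCost_toTest (D := D) (varExpr c.atoms) j
  refine ⟨C, fun σ ⟨g, hg⟩ => hC σ ⟨g, ?_⟩⟩
  rintro _ rfl
  exact hg _ (List.getElem?_eq_some_iff.1 hj).1

/-! ### Testing consistency -/

/-- The families that agree with `g` from index `n` on and whose first `n` members are taken from
the list `l`. -/
def variants {α : Type*} (l : List α) (n : ℕ) (g : ℕ → α) : Set (ℕ → α) :=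
  {g' | (∀ j ≥ n, g' j = g j) ∧ ∀ j < n, g' j ∈ l}

theorem variants_zero {α : Type*} (l : List α) (g : ℕ → α) : variants l 0 g = {g} := by
  ext g'
  simp [variants, funext_iff]

theorem mem_variants_succ {α : Type*} {l : List α} {n : ℕ} {g g' : ℕ → α} :
    g' ∈ variants l (n + 1) g ↔ ∃ a ∈ l, g' ∈ variants l n (Function.update g n a) := by
  constructor
  · rintro ⟨hge, hlt⟩
    refine ⟨g' n, hlt n (by omega), fun j hj => ?_, fun j hj => hlt j (by omega)⟩
    rcases hj.eq_or_lt with rfl | hlt'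
    · simp
    · rw [Function.update_of_ne (by omega), hge j (by omega)]
  · rintro ⟨a, ha, hge, hlt⟩
    refine ⟨fun j hj => ?_, fun j hj => ?_⟩
    · rw [hge j (by omega), Function.update_of_ne (by omega)]
    · rcases (Nat.lt_succ_iff.1 hj).eq_or_lt with rfl | hlt'
      · rwa [hge j le_rfl, Function.update_self]
      · exact hlt j hlt'

theorem DenialConstraint.not_sat_iff {c : DenialConstraint D S} {l : List (DBFact D S)}
    (g : ℕ → DBFact D S) :
    ¬ c.Sat {x | x ∈ l} ↔ ∃ g' ∈ variants l c.atoms.length g, c.ViolatedBy g' := by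
  simp only [Sat, not_forall, not_not]
  constructor
  · rintro ⟨ρ, hatoms, hcond⟩
    have hpick : ∀ j, ∃ f, (c.atoms.length ≤ j → f = g j) ∧
        ∀ a, c.atoms[j]? = some a → f ∈ l ∧ a.Matches ρ f := by
      intro j
      rcases lt_or_ge j c.atoms.length with hj | hj
      · obtain ⟨f, hf, hmatch⟩ := hatoms _ (List.getElem_mem hj)
        refine ⟨f, fun hle => absurd hj hle.not_gt, fun a ha => ?_⟩
        obtain rfl : c.atoms[j] = a := by simpa [List.getElem?_eq_getElem hj] using ha
        exact ⟨hf, hmatch⟩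
      · exact ⟨g j, by simp [List.getElem?_eq_none hj]⟩
    choose g' hge hlt using hpick
    exact ⟨g', ⟨hge, fun j hj => (hlt j _ (List.getElem?_eq_getElem hj)).1⟩, ρ,
      fun j a hj => (hlt j a hj).2, hcond⟩
  · rintro ⟨g', ⟨-, hmem⟩, ρ, hmatch, hcond⟩
    refine ⟨ρ, fun a ha => ?_, hcond⟩
    obtain ⟨j, hj⟩ := List.mem_iff_getElem?.1 ha
    exact ⟨g' j, hmem j (List.getElem?_eq_some_iff.1 hj).1, hmatch j a hj⟩

/-- Raise register `11` if the test succeeds for some choice of `n` facts of the list in register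
`12`; the registers `20, …, 20 + n - 1` run through these choices. -/
def searchTuples (b : Test D Rel) : ℕ → Cmd D Rel
  | 0 => .raiseIf b 11
  | n + 1 => .forEach (20 + n) (.reg 12) (searchTuples b n)

theorem writes_searchTuples {b : Test D Rel} {n k : ℕ} (h : (searchTuples b n).Writes k) :
    k = 11 ∨ 20 ≤ k ∧ k < 20 + n := by
  induction n with
  | zero => simp_all [searchTuples, Cmd.raiseIf, Cmd.Writes]
  | succ n ih =>
    rw [searchTuples, Cmd.writes_forEach] at h
    rcases h with rfl | h
    · omega
    · have := ih h; omega

theorem ensures_searchTuples {b : Test D Rel} {M C : ℕ} {φ : (ℕ → DBFact D S) → Prop}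
    (hφ : ∀ g σ, Loaded (Set.Iio M) g σ → (b.Holds σ ↔ φ g))
    (hC : ∀ σ, (∃ g : ℕ → DBFact D S, Loaded (Set.Iio M) g σ) → b.cost σ ≤ C) (n : ℕ) :
    ∃ p : Polynomial ℕ, ∀ m σ g l N, σ 12 = encodeFacts l → l.length ≤ N →
      Loaded (Set.Ico n M) g σ → Ensures m (searchTuples b n) σ (p.eval N) fun τ =>
        τ 11 ≠ .nil ↔ σ 11 ≠ .nil ∨ ∃ g' ∈ variants l n g, φ g' := by
  induction n with
  | zero =>
    refine ⟨.C (C + 5), fun m σ g l N _ _ hg => ?_⟩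
    replace hg : Loaded (Set.Iio M) g σ := fun j hj => hg j ⟨Nat.zero_le j, hj⟩
    simpa [searchTuples, variants_zero, hφ g σ hg] using
      Ensures.raiseIf (m := m) (k := 11) (hC σ ⟨g, hg⟩)
  | succ n ih =>
    obtain ⟨p, hp⟩ := ih
    refine ⟨.X * (p + 8) + 7, fun m σ g l N hl hN hg => ?_⟩
    have hwrites : ∀ {k}, (Cmd.forEach (20 + n) (.reg 12) (searchTuples b n)).Writes k →
        k = 11 ∨ 20 ≤ k ∧ k < 20 + (n + 1) :=
      writes_searchTuples (b := b) (n := n + 1)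
    refine (Ensures.search (src := .reg 12) (T := p.eval N) (enc := DBFact.encode) (k := 11) hl hN
      (fun h => by have := writes_searchTuples h; omega) (by omega)
      (φ := fun a => ∃ g' ∈ variants l n (Function.update g n a), φ g')
      fun a _ τ hτ hframe => ?_).mono (by simp [Expr.cost]) fun τ hτ => ?_
    · refine hp m τ (Function.update g n a) l N ?_ hN ?_
      · rw [hframe 12 fun h => by have := hwrites h; omega, hl]
      rintro j ⟨hnj, hjM⟩
      rcases hnj.eq_or_lt with rfl | hlt
      · simpa using hτ
      · rw [hframe (20 + j) fun h => by have := hwrites h; omega, hg j ⟨hlt, hjM⟩,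
          Function.update_of_ne (by omega)]
    · rw [hτ]
      refine or_congr_right ⟨?_, ?_⟩
      · rintro ⟨a, ha, g', hg', h⟩
        exact ⟨g', mem_variants_succ.2 ⟨a, ha, hg'⟩, h⟩
      · rintro ⟨g', hg', h⟩
        obtain ⟨a, ha, hg'⟩ := mem_variants_succ.1 hg'
        exact ⟨a, ha, g', hg', h⟩

/-- Raise register `11` if the list of facts in register `12` violates one of the constraints. -/
noncomputable def checkCmd : List (DenialConstraint D S) → Cmd D Rel
  | [] => .skip
  | c :: cs => .seq (searchTuples c.toTest c.atoms.length) (checkCmd cs)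

theorem writes_checkCmd {cs : List (DenialConstraint D S)} {k : ℕ}
    (h : (checkCmd cs).Writes k) : k = 11 ∨ 20 ≤ k := by
  induction cs with
  | nil => exact h.elim
  | cons c cs ih =>
    rcases h with h | h
    · have := writes_searchTuples h; omega
    · exact ih h

theorem ensures_checkCmd (cs : List (DenialConstraint D S)) :
    ∃ p : Polynomial ℕ, ∀ m σ l N, σ 12 = encodeFacts l → l.length ≤ N → l ≠ [] →
      Ensures m (checkCmd cs) σ (p.eval N) fun τ =>
        τ 11 ≠ .nil ↔ σ 11 ≠ .nil ∨ ¬ Consistent {c | c ∈ cs} {x | x ∈ l} := by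
  induction cs with
  | nil => exact ⟨1, fun m σ l N _ _ _ => .skip (by simp) (by simp [Consistent])⟩
  | cons c cs ih =>
    obtain ⟨p, hp⟩ := ih
    obtain ⟨C, hC⟩ := c.boundedCost_toTest
    obtain ⟨q, hq⟩ := ensures_searchTuples (fun g σ => c.holds_toTest) hC c.atoms.length
    refine ⟨q + p + 1, fun m σ l N hl hN hne => ?_⟩
    obtain ⟨f, -⟩ := List.exists_mem_of_ne_nil l hne
    refine .seq (hq m σ (fun _ => f) l N hl hN (by simp [Loaded])) (T₂ := p.eval N)
      (fun τ hτ hframe => (hp m τ l N ?_ hN hne).mono le_rfl fun τ' hτ' => ?_) (by simp)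
    · rw [hframe 12 fun h => by have := writes_searchTuples h; omega, hl]
    · rw [hτ', hτ, ← c.not_sat_iff]
      simp [Consistent, or_assoc, imp_iff_not_or]

end Check

section Program

variable {D : Type u} {Rel : Type v} {S : Schema Rel} {α : Type*} {A I J : Set (DBFact D S)}
  {F : Set (DenialConstraint D S)} {r : DBFact D S → DBFact D S → Prop} {x x₀ : DBFact D S}
  {xs xs₀ : List (DBFact D S)} {J₀ : Set (DBFact D S)} {m : Nondet} {N i k n s dst : ℕ}
  {σ τ : ℕ → Val D Rel}

/-! ### Encodings -/

theorem Val.ofList_injective : Function.Injective (Val.ofList : List (Val D Rel) → Val D Rel) := by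
  intro l
  induction l with
  | nil => rintro (_ | ⟨b, l'⟩) ⟨⟩; rfl
  | cons a l ih =>
    rintro (_ | ⟨b, l'⟩) h
    · cases h
    · obtain ⟨rfl, htail⟩ := Val.cons.inj h
      rw [ih htail]

theorem DBFact.encode_injective : Function.Injective (DBFact.encode : DBFact D S → Val D Rel) := by
  intro f g h
  obtain ⟨hrel, hargs⟩ := Val.cons.inj h
  exact eq_of_rel_args (Val.rel.inj hrel)
    (List.map_injective_iff.2 (fun _ _ => Val.const.inj) (Val.ofList_injective hargs))

theorem Val.length_le_size_ofList (l : List (Val D Rel)) : l.length ≤ (Val.ofList l).size := by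
  induction l with
  | nil => exact Nat.zero_le _
  | cons a l ih => simp only [List.length_cons, Val.ofList, Val.size]; omega

theorem Val.size_le_size_ofList {a : Val D Rel} {l : List (Val D Rel)} (h : a ∈ l) :
    a.size ≤ (Val.ofList l).size := by
  induction h with
  | head => simp only [Val.ofList, Val.size]; omega
  | tail _ _ ih => simp only [Val.ofList, Val.size]; omega

theorem Lists.length_eq_ncard {l : List α} {A : Set α} (h : Lists l A) : l.length = A.ncard := by
  classical
  have hA : A = l.toFinset := by
    ext x
    rw [List.coe_toFinset]
    exact (h.2 x).symm
  rw [hA, Set.ncard_coe_finset, List.toFinset_card_of_nodup h.1]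

theorem Lists.eq_setOf_mem {l : List α} {A : Set α} (h : Lists l A) : A = {x | x ∈ l} :=
  Set.ext fun x => (h.2 x).symm

theorem Lists.filter_reverse {l : List α} {A : Set α} (h : Lists l A) (φ : α → Prop)
    [DecidablePred φ] : Lists (l.filter φ).reverse {x ∈ A | φ x} :=
  ⟨List.nodup_reverse.2 (h.1.filter _), fun x => by simp [h.2]⟩

theorem Lists.cons {l : List α} {A : Set α} {a : α} (h : Lists l A) (ha : a ∉ A) :
    Lists (a :: l) (insert a A) :=
  ⟨List.nodup_cons.2 ⟨mt (h.2 a).1 ha, h.1⟩, fun x => by simp [h.2]⟩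

/-- The register `n` holds an enumeration of the set of facts `A`. -/
def StoresFacts (σ : ℕ → Val D Rel) (n : ℕ) (A : Set (DBFact D S)) : Prop :=
  ∃ l, Lists l A ∧ σ n = encodeFacts l

/-- The register `n` holds an enumeration of the pairs of the relation `r`. -/
def StoresPairs (σ : ℕ → Val D Rel) (n : ℕ) (r : DBFact D S → DBFact D S → Prop) : Prop :=
  ∃ l, Lists l {p : DBFact D S × DBFact D S | r p.1 p.2} ∧ σ n = encodePairs l

theorem StoresFacts.congr (h : StoresFacts σ n A) (hn : τ n = σ n) : StoresFacts τ n A := by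
  rwa [StoresFacts, hn]

theorem StoresPairs.congr (h : StoresPairs σ n r) (hn : τ n = σ n) : StoresPairs τ n r := by
  rwa [StoresPairs, hn]

/-- The number `N` bounds the quantities on which the running time of the program depends: the
numbers of facts and of pairs, and the sizes of the facts. -/
structure SizeBound (I : Set (DBFact D S)) (r : DBFact D S → DBFact D S → Prop) (N : ℕ) :
    Prop where
  finite : I.Finite
  ncard_le : I.ncard ≤ N
  size_le : ∀ x ∈ I, (x.encode : Val D Rel).size ≤ N
  ncard_pairs_le : {p : DBFact D S × DBFact D S | r p.1 p.2}.ncard ≤ N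
  rel_mem : ∀ x y, r x y → x ∈ I ∧ y ∈ I

theorem EncodesInput.sizeBound {v : Val D Rel} (h : EncodesInput v I r) (hI : I.Finite)
    (hr : IsPriority I F r) : SizeBound I r v.size := by
  obtain ⟨lI, lr, hlI, hlr, rfl⟩ := h
  refine ⟨hI, ?_, fun x hx => ?_, ?_, fun x y h =>
    ⟨(hr.neighbors x y h).left_mem, (hr.neighbors x y h).right_mem⟩⟩
  · have := Val.length_le_size_ofList (lI.map (DBFact.encode : _ → Val D Rel))
    rw [List.length_map, hlI.length_eq_ncard] at this
    simp only [Val.size, encodeFacts]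
    omega
  · have : x.encode ∈ lI.map (DBFact.encode : _ → Val D Rel) :=
      List.mem_map_of_mem ((hlI.2 x).2 hx)
    have := Val.size_le_size_ofList this
    simp only [Val.size, encodeFacts]
    omega
  · have := Val.length_le_size_ofList
      (lr.map fun p => (.cons p.1.encode p.2.encode : Val D Rel))
    rw [List.length_map, hlr.length_eq_ncard] at this
    simp only [Val.size, encodePairs]
    omega

theorem SizeBound.ncard_le_of_subset (hN : SizeBound I r N) (hA : A ⊆ I) : A.ncard ≤ N :=
  (Set.ncard_le_ncard hA hN.finite).trans hN.ncard_le

/-! ### Computing the winnow -/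

/-- The pair at the head of register `8` says that the fact at the head of register `9` dominates
the fact at the head of register `6`. -/
def dominatesTest : Test D Rel :=
  .and (.same (.tl (.hd (.reg 8))) (.hd (.reg 6))) (.same (.hd (.hd (.reg 8))) (.hd (.reg 9)))

theorem holds_dominatesTest_iff {p : DBFact D S × DBFact D S} {y : DBFact D S}
    (hx : (σ 6).hd = x.encode) (hp : (σ 8).hd = .cons p.1.encode p.2.encode)
    (hy : (σ 9).hd = y.encode) : dominatesTest.Holds σ ↔ p.2 = x ∧ p.1 = y := by
  simp only [dominatesTest, Test.Holds, Expr.eval, hx, hp, hy, Val.hd_cons, Val.tl_cons,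
    DBFact.encode_injective.eq_iff]

theorem SizeBound.cost_dominatesTest_le (hN : SizeBound I r N) {p : DBFact D S × DBFact D S}
    {y : DBFact D S} (hx : (σ 6).hd = x.encode) (hp : (σ 8).hd = .cons p.1.encode p.2.encode)
    (hy : (σ 9).hd = y.encode) (hxI : x ∈ I) (hyI : y ∈ I) (hpr : r p.1 p.2) :
    dominatesTest.cost σ ≤ 4 * N + 13 := by
  have hsize_x := hN.size_le x hxI
  have hsize_y := hN.size_le y hyI
  have hsize_fst := hN.size_le _ (hN.rel_mem _ _ hpr).1
  have hsize_snd := hN.size_le _ (hN.rel_mem _ _ hpr).2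
  simp only [dominatesTest, Test.cost, Expr.cost, Expr.eval, hx, hp, hy, Val.hd_cons, Val.tl_cons]
  omega

/-- Raise register `7` if the fact at the head of register `6` is dominated, according to the pairs
in register `2`, by one of the facts in register `1`. -/
def dominatedCmd : Cmd D Rel :=
  .forEach 8 (.reg 2) (.forEach 9 (.reg 1) (.raiseIf dominatesTest 7))

theorem writes_dominatedCmd (h : (dominatedCmd : Cmd D Rel).Writes k) : 7 ≤ k ∧ k ≤ 9 := by
  simp only [dominatedCmd, Cmd.writes_forEach, Cmd.raiseIf, Cmd.Writes, or_false] at h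
  omega

theorem ensures_dominatedCmd (hN : SizeBound I r N) (hA : A ⊆ I) (hx : x ∈ I)
    (hσA : StoresFacts σ 1 A) (hσr : StoresPairs σ 2 r) (hσx : (σ 6).hd = x.encode) :
    Ensures m dominatedCmd σ (N * (N * (4 * N + 26) + 15) + 7) fun τ =>
      τ 7 ≠ .nil ↔ σ 7 ≠ .nil ∨ ∃ y ∈ A, r y x := by
  obtain ⟨lA, hlA, hσA⟩ := hσA
  obtain ⟨lr, hlr, hσr⟩ := hσr
  refine (Ensures.search (k := 7) (src := .reg 2) (T := N * (4 * N + 26) + 7) (l := lr)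
    (enc := fun p => .cons p.1.encode p.2.encode) (φ := fun p => ∃ y ∈ lA, p.2 = x ∧ p.1 = y)
    (by simpa only [Expr.eval, encodePairs] using hσr)
    (hlr.length_eq_ncard.trans_le hN.ncard_pairs_le)
    (by simp [Cmd.writes_forEach, Cmd.raiseIf, Cmd.Writes]) (by decide)
    fun p hp τ hτp hfr => ?_).mono le_rfl fun τ hτ => hτ.trans ?_
  · refine Ensures.search (k := 7) (src := .reg 1) (T := 4 * N + 18) (enc := DBFact.encode)
      ((hfr 1 (by rintro h; have := writes_dominatedCmd h; omega)).trans hσA)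
      (hlA.length_eq_ncard.trans_le (hN.ncard_le_of_subset hA)) (by simp [Cmd.raiseIf, Cmd.Writes])
      (by decide) fun y hy τ' hτ'y hfr' => ?_
    have hτ'p : (τ' 8).hd = .cons p.1.encode p.2.encode := by
      rw [hfr' 8 (by simp [Cmd.writes_forEach, Cmd.raiseIf, Cmd.Writes]), hτp]
    have hτ'x : (τ' 6).hd = x.encode := by
      rw [hfr' 6 (by simp [Cmd.writes_forEach, Cmd.raiseIf, Cmd.Writes]),
        hfr 6 (by rintro h; have := writes_dominatedCmd h; omega), hσx]
    refine (Ensures.raiseIf (hN.cost_dominatesTest_le hτ'x hτ'p hτ'y hx (hA ((hlA.2 y).1 hy))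
      ((hlr.2 p).1 hp))).mono le_rfl fun τ'' h => h.trans ?_
    rw [holds_dominatesTest_iff hτ'x hτ'p hτ'y]
  · refine or_congr_right ⟨?_, fun ⟨y, hy, hyx⟩ =>
      ⟨(y, x), (hlr.2 _).2 hyx, y, (hlA.2 y).2 hy, rfl, rfl⟩⟩
    rintro ⟨⟨y, x⟩, hp, y, hy, rfl, rfl⟩
    exact ⟨y, (hlA.2 y).1 hy, (hlr.2 _).1 hp⟩

/-- Collect in register `13` the winnow of the facts in register `1` with respect to the pairs in
register `2`. -/
def winnowCmd : Cmd D Rel :=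
  .filter 6 13 (.reg 1) (.seq (.assign 7 .nil) dominatedCmd) (.isNil (.reg 7))

theorem writes_winnowCmd (h : (winnowCmd : Cmd D Rel).Writes k) : 6 ≤ k := by
  rw [winnowCmd, Cmd.writes_filter] at h
  rcases h with rfl | rfl | rfl | h
  iterate 3 omega
  · have := writes_dominatedCmd h; omega

theorem ensures_winnowCmd (hN : SizeBound I r N) (hA : A ⊆ I) (hσA : StoresFacts σ 1 A)
    (hσr : StoresPairs σ 2 r) :
    Ensures m winnowCmd σ (N * (N * (N * (4 * N + 26) + 15) + 27) + 10) fun τ =>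
      StoresFacts τ 13 (winnow r A) := by
  classical
  have hσA' := hσA
  obtain ⟨l, hl, hσl⟩ := hσA'
  refine (Ensures.filter (enc := DBFact.encode) (φ := fun x => ¬ ∃ y ∈ A, r y x) (l := l)
    (T := N * (N * (4 * N + 26) + 15) + 10) (B := 2)
    (by simpa [Expr.eval, encodeFacts] using hσl)
    (hl.length_eq_ncard.trans_le (hN.ncard_le_of_subset hA)) ?_ ?_ (by decide)
    fun x hx τ hτx hfr => ?_).mono le_rfl fun τ hτ => ⟨_, hl.filter_reverse _, hτ⟩
  iterate 2
    rintro (h | h)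
    · cases h
    · have := writes_dominatedCmd h; omega
  have hframe : ∀ n ≤ 5, Function.update τ 7 .nil n = σ n := fun n hn => by
    rw [Function.update_of_ne (by omega), hfr n fun h => by have := writes_winnowCmd h; omega]
  refine .assign_seq ((ensures_dominatedCmd hN hA (hA ((hl.2 x).1 hx))
    (hσA.congr (hframe 1 (by decide))) (hσr.congr (hframe 2 (by decide))) hτx).mono le_rfl
    fun τ' hτ' => ⟨?_, le_rfl⟩) (by simp only [Expr.cost]; omega)
  simp only [Function.update_self, ne_eq, not_true_eq_false, false_or] at hτ'
  exact (not_iff_comm.1 hτ').symm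

/-- Put into register `dst` an arbitrarily chosen element of the list in register `s`, iterating
with register `i`. -/
def Cmd.pick (i dst s : ℕ) : Cmd D Rel :=
  .seq (.assign dst (.hd (.reg s)))
    (.forEach i (.tl (.reg s)) (.choose (.assign dst (.hd (.reg i))) .skip))

theorem Cmd.writes_pick : (Cmd.pick i dst s : Cmd D Rel).Writes k ↔ k = dst ∨ k = i := by
  simp only [pick, Writes, writes_forEach]
  tauto

theorem Ensures.pick {enc : α → Val D Rel} {l : List α} {a₀ : α}
    (hs : σ s = .ofList (l.map enc)) (hlen : l.length ≤ N) (ha₀ : a₀ ∈ l) (hi : dst ≠ i)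
    (hdst : s ≠ dst) :
    Ensures m (Cmd.pick i dst s) σ (N * 12 + 12) fun τ =>
      ∃ a ∈ l, τ dst = enc a ∧ (m = .angelic → a = a₀) := by
  obtain ⟨b, l, rfl⟩ := List.exists_cons_of_ne_nil (List.ne_nil_of_mem ha₀)
  refine .assign_seq ((Ensures.forEach (T := 4) (l := l) (enc := enc) (Inv := fun pre τ =>
      ∃ a ∈ b :: pre, τ dst = enc a ∧ (m = .angelic → a₀ ∈ b :: pre → a = a₀)) ?_
      ((Nat.le_succ _).trans hlen) (by simp [Cmd.Writes, hi.symm])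
      (fun pre τ v h => ?_) ⟨b, by simp, ?_, ?_⟩
      fun pre a post τ _ hτ _ ⟨c, hc, hτc, hm⟩ => ?_).mono le_rfl fun τ ⟨a, ha, hτa, hm⟩ =>
        ⟨a, ha, hτa, fun h => hm h ha₀⟩)
    (by simp only [Expr.cost]; omega)
  · simp [Expr.eval, Function.update_of_ne hdst, hs, Val.ofList]
  · rwa [Function.update_of_ne hi]
  · simp [Expr.eval, hs, Val.ofList]
  · simpa using fun _ => Eq.symm
  have htake : Ensures m (.assign dst (.hd (.reg i))) τ 3 fun τ => τ dst = enc a :=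
    .assign le_rfl (by simp [Expr.eval, hτ, Val.ofList])
  have hkeep : Ensures m .skip τ 3 fun τ => τ dst = enc c := .skip (by decide) hτc
  cases m with
  | demonic =>
    exact .choose (htake.mono le_rfl fun _ h => ⟨a, by simp, h, nofun⟩)
      (hkeep.mono le_rfl fun _ h => ⟨c, List.mem_append_left [a] hc, h, nofun⟩) le_rfl
  | angelic =>
    by_cases ha : a = a₀
    · exact .choose_left (htake.mono le_rfl fun _ h => ⟨a, by simp, h, fun _ _ => ha⟩) le_rfl
    · refine .choose_right (hkeep.mono le_rfl fun _ h =>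
        ⟨c, List.mem_append_left [a] hc, h, fun _ h => hm rfl ?_⟩) le_rfl
      simpa [Ne.symm ha] using h

/-! ### The greedy program -/

/-- Choose a fact from the winnow of the facts in register `1` and put it into register `5`. -/
def chooseCmd : Cmd D Rel :=
  .seq winnowCmd (.pick 6 5 13)

theorem writes_chooseCmd (h : (chooseCmd : Cmd D Rel).Writes k) : 5 ≤ k := by
  rcases h with h | h
  · exact (Nat.le_succ 5).trans (writes_winnowCmd h)
  · have := Cmd.writes_pick.1 h; omega

theorem ensures_chooseCmd (hN : SizeBound I r N) (hA : A ⊆ I) (hσA : StoresFacts σ 1 A)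
    (hσr : StoresPairs σ 2 r) (hx₀ : x₀ ∈ winnow r A) :
    Ensures m chooseCmd σ (N * (N * (N * (4 * N + 26) + 15) + 39) + 23) fun τ =>
      ∃ x ∈ winnow r A, τ 5 = x.encode ∧ (m = .angelic → x = x₀) := by
  refine .seq (ensures_winnowCmd hN hA hσA hσr) (T₂ := N * 12 + 12) (fun τ ⟨l, hl, hτ⟩ _ => ?_)
    (Eq.le (by ring))
  have hlen : l.length ≤ N :=
    hl.length_eq_ncard.trans_le (hN.ncard_le_of_subset fun _ hx => hA hx.1)
  exact (Ensures.pick hτ hlen ((hl.2 x₀).2 hx₀) (by decide) (by decide)).mono le_rfl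
    fun τ ⟨x, hx, hτ⟩ => ⟨x, (hl.2 x).1 hx, hτ⟩

/-- Remove the fact in register `5` from the list in register `1`. -/
def removeCmd : Cmd D Rel :=
  .seq (.filter 6 10 (.reg 1) .skip (.not (.same (.hd (.reg 6)) (.reg 5)))) (.assign 1 (.reg 10))

theorem writes_removeCmd (h : (removeCmd : Cmd D Rel).Writes k) : k = 1 ∨ 6 ≤ k := by
  simp only [removeCmd, Cmd.Writes, Cmd.writes_filter, or_false] at h
  omega

theorem ensures_removeCmd (hN : SizeBound I r N) (hA : A ⊆ I) (hσA : StoresFacts σ 1 A)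
    (hx : x ∈ I) (hσx : σ 5 = x.encode) :
    Ensures m removeCmd σ (N * (2 * N + 21) + 13) fun τ => StoresFacts τ 1 (A \ {x}) := by
  classical
  obtain ⟨l, hl, hσl⟩ := hσA
  refine .seq (Ensures.filter (enc := DBFact.encode) (φ := (· ≠ x)) (l := l) (T := 1)
    (B := 2 * N + 5) (by simpa [Expr.eval, encodeFacts] using hσl)
    (hl.length_eq_ncard.trans_le (hN.ncard_le_of_subset hA)) id id (by decide)
    fun y hy τ hτy hfr => ?_) (T₂ := 2) (fun τ hτ _ => .assign le_rfl ?_) (Eq.le ?_)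
  · have hτx : τ 5 = x.encode := (hfr 5 (by simp [Cmd.writes_filter, Cmd.Writes])).trans hσx
    have hsize_x := hN.size_le x hx
    have hsize_y := hN.size_le y (hA ((hl.2 y).1 hy))
    refine .skip le_rfl ⟨?_, ?_⟩
    · simp only [Test.Holds, Expr.eval, hτy, hτx, DBFact.encode_injective.eq_iff, ne_eq]
    · simp only [Test.cost, Expr.cost, Expr.eval, hτy, hτx]
      omega
  · exact ⟨_, hl.filter_reverse _, (Function.update_self ..).trans hτ⟩
  · simp only [Expr.cost]
    ring

/-- Add the fact in register `5` to the list in register `4` if the result is consistent. -/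
noncomputable def keepCmd (cs : List (DenialConstraint D S)) : Cmd D Rel :=
  .seq (.assign 12 (.cons (.reg 5) (.reg 4))) (.seq (.assign 11 .nil)
    (.seq (checkCmd cs) (.ite (.isNil (.reg 11)) (.assign 4 (.reg 12)) .skip)))

theorem writes_keepCmd {cs : List (DenialConstraint D S)} (h : (keepCmd cs).Writes k) :
    k = 4 ∨ 6 ≤ k := by
  simp only [keepCmd, Cmd.Writes] at h
  rcases h with h | h | h | h | h
  · omega
  · omega
  · have := writes_checkCmd h; omega
  · omega
  · cases h

theorem ensures_keepCmd (cs : List (DenialConstraint D S)) :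
    ∃ p : Polynomial ℕ, ∀ {I r N J x m} {σ : ℕ → Val D Rel}, SizeBound I r N → J ⊆ I → x ∈ I →
      x ∉ J → StoresFacts σ 4 J → σ 5 = x.encode →
      Ensures m (keepCmd cs) σ (p.eval N) fun τ =>
        StoresFacts τ 4 (tryInsert {c | c ∈ cs} J x) := by
  obtain ⟨p, hp⟩ := ensures_checkCmd cs
  refine ⟨p + 14, fun {I r N J x m σ} hN hJ hx hxJ hσJ hσx => ?_⟩
  obtain ⟨l, hl, hσl⟩ := hσJ
  have hl' : Lists (x :: l) (insert x J) := hl.cons hxJ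
  let e : Expr D Rel := .cons (.reg 5) (.reg 4)
  let σ' := Function.update (Function.update σ 12 (e.eval σ)) 11 .nil
  have hσ'12 : σ' 12 = encodeFacts (x :: l) := by
    simp [σ', e, Expr.eval, hσx, hσl, encodeFacts, Val.ofList]
  have hσ'4 : σ' 4 = encodeFacts l := by simp [σ', hσl]
  have hcheck := hp m σ' (x :: l) N hσ'12 (hl'.length_eq_ncard.trans_le
    (hN.ncard_le_of_subset (Set.insert_subset hx hJ))) (List.cons_ne_nil x l)
  rw [← hl'.eq_setOf_mem] at hcheck
  have hkeep : Ensures m (.seq (checkCmd cs) (.ite (.isNil (.reg 11)) (.assign 4 (.reg 12)) .skip))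
      σ' (p.eval N + 6) fun τ => StoresFacts τ 4 (tryInsert {c | c ∈ cs} J x) := by
    refine .seq (T₂ := 5) hcheck (fun τ hτ hfr => ?_) le_rfl
    have hframe : ∀ n, n ≠ 11 → n < 20 → τ n = σ' n := fun n hn hn' =>
      hfr n fun h => by have := writes_checkCmd h; omega
    have hτ11 : τ 11 = .nil ↔ Consistent {c | c ∈ cs} (insert x J) := by
      simpa [σ', not_iff_not] using hτ
    refine .ite (T₁ := 2) (fun h => .assign le_rfl ?_) (fun h => .skip (by decide) ?_) le_rfl
    · rw [tryInsert_of_consistent (hτ11.1 h)]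
      exact ⟨_, hl', (Function.update_self ..).trans
        ((hframe 12 (by decide) (by decide)).trans hσ'12)⟩
    · rw [tryInsert_of_not_consistent (mt hτ11.2 h)]
      exact ⟨l, hl, (hframe 4 (by decide) (by decide)).trans hσ'4⟩
  refine .assign_seq (T₁ := p.eval N + 9) (.assign_seq hkeep ?_) ?_
  · simp only [Expr.cost]; omega
  · simp only [Expr.cost, Polynomial.eval_add, Polynomial.eval_ofNat]; omega

/-- The state of the greedy program in an iteration of its main loop: the remaining facts `A`, the
pairs of the priority, the choices `xs` made so far, the last one first, and the facts `J` kept so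
far. -/
structure GreedyState (r : DBFact D S → DBFact D S → Prop) (A J : Set (DBFact D S))
    (xs : List (DBFact D S)) (σ : ℕ → Val D Rel) : Prop where
  remaining : StoresFacts σ 1 A
  pairs : StoresPairs σ 2 r
  choices : σ 3 = encodeFacts xs.reverse
  kept : StoresFacts σ 4 J

/-- One iteration of the main loop. -/
noncomputable def stepCmd (cs : List (DenialConstraint D S)) : Cmd D Rel :=
  .seq chooseCmd (.seq removeCmd (.seq (keepCmd cs) (.assign 3 (.cons (.reg 5) (.reg 3)))))

theorem ensures_stepCmd (cs : List (DenialConstraint D S)) :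
    ∃ p : Polynomial ℕ, ∀ {I r N A J xs x₀ m} {σ : ℕ → Val D Rel}, SizeBound I r N → A ⊆ I →
      J ⊆ I → Disjoint A J → GreedyState r A J xs σ → x₀ ∈ winnow r A →
      Ensures m (stepCmd cs) σ (p.eval N) fun τ => ∃ x ∈ winnow r A, (m = .angelic → x = x₀) ∧
        GreedyState r (A \ {x}) (tryInsert {c | c ∈ cs} J x) (xs ++ [x]) τ := by
  obtain ⟨p, hp⟩ := ensures_keepCmd cs
  let X : Polynomial ℕ := .X
  refine ⟨X * (X * (X * (4 * X + 26) + 15) + 39) + X * (2 * X + 21) + p + 43,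
    fun {I r N A J xs x₀ m σ} hN hA hJ hAJ hσ hx₀ => ?_⟩
  refine .seq (ensures_chooseCmd hN hA hσ.remaining hσ.pairs hx₀)
    (T₂ := N * (2 * N + 21) + p.eval N + 19) (fun τ ⟨x, hx, hτx, hm⟩ hτ => ?_) ?_
  · have hτ (n) (hn : n < 5) : τ n = σ n := hτ n fun h => by have := writes_chooseCmd h; omega
    have hxI : x ∈ I := hA hx.1
    refine .seq (ensures_removeCmd hN hA (hσ.remaining.congr (hτ 1 (by decide))) hxI hτx)
      (T₂ := p.eval N + 5) (fun τ₁ hA₁ hτ₁ => ?_) (by omega)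
    have hτ₁ (n) (hn : 1 < n ∧ n < 6) : τ₁ n = τ n :=
      hτ₁ n fun h => by have := writes_removeCmd h; omega
    refine .seq (hp hN hJ hxI (Set.disjoint_left.1 hAJ hx.1) (hσ.kept.congr
      ((hτ₁ 4 (by decide)).trans (hτ 4 (by decide)))) ((hτ₁ 5 (by decide)).trans hτx))
      (T₂ := 4) (fun τ₂ hJ₂ hτ₂ => ?_) le_rfl
    have hτ₂ (n) (hn : n < 4 ∨ n = 5) : τ₂ n = τ₁ n :=
      hτ₂ n fun h => by have := writes_keepCmd h; omega
    refine .assign le_rfl ⟨x, hx, hm, ?_, ?_, ?_, ?_⟩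
    · exact hA₁.congr (hτ₂ 1 (by decide))
    · exact hσ.pairs.congr
        ((hτ₂ 2 (by decide)).trans ((hτ₁ 2 (by decide)).trans (hτ 2 (by decide))))
    · simp [Expr.eval, hτ₂, hτ₁, hτ, hτx, hσ.choices, encodeFacts, Val.ofList]
    · exact hJ₂
  · simp only [X, Polynomial.eval_add, Polynomial.eval_mul, Polynomial.eval_X,
      Polynomial.eval_ofNat]
    omega

/-- In angelic mode, the choices `xs` made so far on the way to the state `(A, J)` can be continued
to the prescribed sequence of choices `xs₀` with result `J₀`. -/
def OnCourse (m : Nondet) (F : Set (DenialConstraint D S))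
    (r : DBFact D S → DBFact D S → Prop) (xs₀ : List (DBFact D S)) (J₀ A J : Set (DBFact D S))
    (xs : List (DBFact D S)) : Prop :=
  m = .angelic → ∃ ys, xs₀ = xs ++ ys ∧ Run F r A J ys ∅ J₀

theorem OnCourse.exists_choice (h : OnCourse m F r xs₀ J₀ A J xs)
    (hr : ∀ x, ¬ Relation.TransGen r x x) (hA : A.Finite) (hne : A.Nonempty) :
    ∃ x ∈ winnow r A, OnCourse m F r xs₀ J₀ (A \ {x}) (tryInsert F J x) (xs ++ [x]) := by
  cases m with
  | demonic =>
    obtain ⟨x, hx⟩ := winnow_nonempty hr hA hne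
    exact ⟨x, hx, nofun⟩
  | angelic =>
    obtain ⟨_ | ⟨x, ys⟩, hxs, hrun⟩ := h rfl
    · exact absurd (run_nil_iff.1 hrun).1 hne.ne_empty
    · obtain ⟨hx, hrun⟩ := run_cons_iff.1 hrun
      exact ⟨x, hx, fun _ => ⟨ys, by simp [hxs], hrun⟩⟩

theorem OnCourse.eq_of_empty (h : OnCourse m F r xs₀ J₀ ∅ J xs) (hm : m = .angelic) :
    xs = xs₀ ∧ J = J₀ := by
  obtain ⟨_ | ⟨x, ys⟩, rfl, hrun⟩ := h hm
  · exact ⟨(List.append_nil xs).symm, (run_nil_iff.1 hrun).2⟩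
  · exact (run_cons_iff.1 hrun).1.1.elim

/-- The invariant of the main loop with `k` remaining iterations. -/
def LoopInvariant (m : Nondet) (I : Set (DBFact D S)) (F : Set (DenialConstraint D S))
    (r : DBFact D S → DBFact D S → Prop) (xs₀ : List (DBFact D S)) (J₀ : Set (DBFact D S))
    (k : ℕ) (σ : ℕ → Val D Rel) : Prop :=
  ∃ A J xs, A.ncard = k ∧ GreedyState r A J xs σ ∧ Run F r I ∅ xs A J ∧
    OnCourse m F r xs₀ J₀ A J xs

theorem Run.disjoint_kept (h : Run F r I ∅ xs A J) : Disjoint A J := by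
  rw [h.remaining_eq, Set.disjoint_left]
  exact fun x hx hxJ => hx.2 ((h.kept_subset hxJ).resolve_left (Set.notMem_empty x))

theorem StoresFacts.eq_nil_iff (h : StoresFacts σ k A) : σ k = .nil ↔ A.ncard = 0 := by
  obtain ⟨l, hl, h⟩ := h
  rw [h, encodeFacts, Val.ofList_eq_nil_iff, List.map_eq_nil_iff, ← List.length_eq_zero_iff,
    hl.length_eq_ncard]

theorem ensures_loop (cs : List (DenialConstraint D S)) :
    ∃ p : Polynomial ℕ, ∀ {I r N xs₀ J₀ m} {σ : ℕ → Val D Rel}, SizeBound I r N →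
      (∀ x, ¬ Relation.TransGen r x x) → LoopInvariant m I {c | c ∈ cs} r xs₀ J₀ I.ncard σ →
      Ensures m (.loop (.not (.isNil (.reg 1))) (stepCmd cs)) σ (p.eval N)
        (LoopInvariant m I {c | c ∈ cs} r xs₀ J₀ 0) := by
  obtain ⟨p, hp⟩ := ensures_stepCmd cs
  refine ⟨.X * (p + 4) + 4, fun {I r N xs₀ J₀ m σ} hN hr hσ => ?_⟩
  have htime : I.ncard * (p.eval N + 3 + 1) + 3 + 1 ≤ (Polynomial.X * (p + 4) + 4).eval N := by
    have : I.ncard * (p.eval N + 3 + 1) ≤ N * (p.eval N + 4) :=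
      Nat.mul_le_mul_right _ hN.ncard_le
    simp only [Polynomial.eval_add, Polynomial.eval_mul, Polynomial.eval_X, Polynomial.eval_ofNat]
    omega
  refine (Ensures.loop (T := p.eval N) (B := 3) (Inv := LoopInvariant m I {c | c ∈ cs} r xs₀ J₀)
    ?_ ?_ hσ).mono htime fun _ => id
  · rintro k σ ⟨A, J, xs, hk, hσ, hrun, hm⟩
    have hA : A ⊆ I := hrun.remaining_eq ▸ Set.sdiff_subset
    have hAfin : A.Finite := hN.finite.subset hA
    have hne : A.Nonempty := Set.nonempty_of_ncard_ne_zero (by omega)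
    obtain ⟨x₀, hx₀, hm⟩ := hm.exists_choice hr hAfin hne
    refine ⟨hσ.remaining.eq_nil_iff.not.2 (by omega), le_rfl,
      (hp hN hA hrun.kept_subset_init hrun.disjoint_kept hσ hx₀).mono le_rfl ?_⟩
    rintro τ ⟨x, hx, hxx₀, hτ⟩
    refine ⟨_, _, _, ?_, hτ, run_append_iff.2 ⟨A, J, hrun, run_cons_iff.2 ⟨hx, .refl _ _⟩⟩, ?_⟩
    · have := Set.ncard_sdiff_singleton_add_one hx.1 hAfin
      omega
    · intro hmt
      obtain rfl := hxx₀ hmt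
      exact hm hmt
  · rintro σ ⟨A, J, xs, hk, hσ, -, -⟩
    exact ⟨not_not.2 (hσ.remaining.eq_nil_iff.2 hk), le_rfl⟩

/-- Return the sequence of choices together with the facts kept. -/
def reportCmd : Cmd D Rel :=
  .seq (.filter 6 10 (.reg 3) .skip (.isNil .nil)) (.assign 0 (.cons (.reg 10) (.reg 4)))

theorem ensures_reportCmd (hN : SizeBound I r N) (hσ : LoopInvariant m I F r xs₀ J₀ 0 σ) :
    Ensures m reportCmd σ (N * 18 + 15) fun τ => ∃ xs J, Execution I F r xs J ∧
      EncodesOutput (τ 0) xs J ∧ (m = .angelic → xs = xs₀ ∧ J = J₀) := by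
  obtain ⟨A, J, xs, hA, hσ, hrun, hm⟩ := hσ
  obtain rfl : A = ∅ := (Set.ncard_eq_zero
    (hN.finite.subset (hrun.remaining_eq ▸ Set.sdiff_subset))).1 hA
  obtain ⟨lJ, hlJ, hσJ⟩ := hσ.kept
  refine .seq (Ensures.filter (enc := DBFact.encode) (φ := fun _ => True) (l := xs.reverse) (T := 1)
    (B := 2) (by simpa [Expr.eval, encodeFacts] using hσ.choices) ?_ id id (by decide)
    fun _ _ _ _ _ => .skip le_rfl (by simp [Test.Holds, Test.cost, Expr.eval, Expr.cost]))
    (T₂ := 4) (fun τ hτ hfr => .assign le_rfl ?_) le_rfl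
  · exact (List.length_reverse ..).trans_le ((hrun.length_le hN.finite).trans hN.ncard_le)
  · have hτJ : τ 4 = encodeFacts lJ := (hfr 4 (by simp [Cmd.writes_filter, Cmd.Writes])).trans hσJ
    refine ⟨xs, J, ⟨∅, hrun, winnow_empty⟩, ⟨lJ, hlJ, ?_⟩, hm.eq_of_empty⟩
    simp [Expr.eval, hτ, hτJ, encodeFacts]

theorem EncodesInput.loopInvariant {v : Val D Rel} (h : EncodesInput v I r)
    (hm : OnCourse m F r xs₀ J₀ I ∅ []) (h₁ : σ 1 = v.hd) (h₂ : σ 2 = v.tl) (h₃ : σ 3 = .nil)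
    (h₄ : σ 4 = .nil) : LoopInvariant m I F r xs₀ J₀ I.ncard σ := by
  obtain ⟨lI, lr, hlI, hlr, rfl⟩ := h
  exact ⟨I, ∅, [], rfl, ⟨⟨lI, hlI, h₁⟩, ⟨lr, hlr, h₂⟩, h₃, [], ⟨.nil, by simp⟩, h₄⟩, .refl _ _, hm⟩

/-- The greedy algorithm as a program. -/
noncomputable def greedyCmd (cs : List (DenialConstraint D S)) : Cmd D Rel :=
  .seq (.assign 1 (.hd (.reg 0))) (.seq (.assign 2 (.tl (.reg 0)))
    (.seq (.loop (.not (.isNil (.reg 1))) (stepCmd cs)) reportCmd))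

theorem ensures_greedyCmd (cs : List (DenialConstraint D S)) :
    ∃ p : Polynomial ℕ, ∀ m I r input xs₀ J₀, I.Finite → IsPriority I {c | c ∈ cs} r →
      EncodesInput input I r → (m = .angelic → Execution I {c | c ∈ cs} r xs₀ J₀) →
      Ensures m (greedyCmd cs) (Function.update (fun _ => .nil) 0 input) (p.eval input.size)
        fun τ => ∃ xs J, Execution I {c | c ∈ cs} r xs J ∧ EncodesOutput (τ 0) xs J ∧
          (m = .angelic → xs = xs₀ ∧ J = J₀) := by
  obtain ⟨p, hp⟩ := ensures_loop cs
  refine ⟨p + .X * 18 + 24, fun m I r input xs₀ J₀ hI hr hin hm => ?_⟩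
  have hN : SizeBound I r input.size := hin.sizeBound hI hr
  have hcourse : OnCourse m {c | c ∈ cs} r xs₀ J₀ I ∅ [] := fun h =>
    ⟨xs₀, rfl, (execution_iff_run hI hr.acyclic).1 (hm h)⟩
  refine .assign_seq (T₁ := p.eval input.size + input.size * 18 + 20) (.assign_seq
    (.seq (hp hN hr.acyclic (hin.loopInvariant hcourse ?_ ?_ ?_ ?_))
      (fun τ hτ _ => ensures_reportCmd hN hτ) le_rfl) ?_) ?_
  iterate 4 simp [Expr.eval]
  · simp only [Expr.cost]
    omega
  · simp only [Expr.cost, Polynomial.eval_add, Polynomial.eval_mul, Polynomial.eval_X,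
      Polynomial.eval_ofNat]
    omega

theorem implements_greedyCmd (cs : List (DenialConstraint D S)) :
    Implements (greedyCmd cs) {c | c ∈ cs} := by
  obtain ⟨p, hp⟩ := ensures_greedyCmd cs
  refine fun I r input hI hr hin => ⟨fun out hout => ?_, fun xs J hex => ?_⟩
  · refine Ensures.of_returns (R := fun v => ∃ xs J, Execution I {c | c ∈ cs} r xs J ∧
      EncodesOutput v xs J) ((hp .demonic I r input [] ∅ hI hr hin nofun).mono le_rfl ?_) hout
    exact fun τ ⟨xs, J, hex, hout, _⟩ => ⟨xs, J, hex, hout⟩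
  · obtain ⟨τ, ⟨xs', J', -, hout, heq⟩, hret⟩ :=
      (hp .angelic I r input xs J hI hr hin fun _ => hex).exists_returns
    obtain ⟨rfl, rfl⟩ := heq rfl
    exact ⟨τ 0, hret, hout⟩

theorem polyTime_greedyCmd (cs : List (DenialConstraint D S)) :
    PolyTime (greedyCmd cs) {c | c ∈ cs} := by
  obtain ⟨p, hp⟩ := ensures_greedyCmd cs
  exact ⟨p, fun I r input hI hr hin => (hp .demonic I r input [] ∅ hI hr hin nofun).haltsWithin⟩

end Program

end PrefRepair

theorem mainTheorem5 {D Rel : Type*} (S : Schema Rel) (F : Set (DenialConstraint D S)) :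
    (∀ (I : Set (DBFact D S)) (r : DBFact D S → DBFact D S → Prop), I.Finite → IsPriority I F r →
      -- soundness and completeness
      {J | ∃ xs, Execution I F r xs J} = CRep I F r ∧
      -- termination: no run of the main loop makes more than `|I|` iterations
      ∀ xs A J, Run F r I ∅ xs A J → xs.length ≤ I.ncard) ∧
    -- polynomial running time
    (F.Finite → ∃ P : Cmd D Rel, Implements P F ∧ PolyTime P F) := by
  refine ⟨fun I r hI hr => ⟨outputs_eq_cRep hI hr, fun xs A J h => h.length_le hI⟩, fun hF => ?_⟩
  obtain ⟨cs, rfl⟩ : ∃ cs : List (DenialConstraint D S), {c | c ∈ cs} = F :=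
    ⟨hF.toFinset.toList, by ext c; simp⟩
  exact ⟨greedyCmd cs, implements_greedyCmd cs, polyTime_greedyCmd cs⟩
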